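/- Let $K=\mathbb{Q}(\omega)$, $\omega=e^{2\pi i/3}$, with ring of integers $\mathcal{O}=\mathbb{Z}[\omega]$ and $\delta=\sqrt{-3}$. Write $x'$ for the conjugate of $x\in K$, $e(x)=\exp\left(2\pi i\left(\frac{x}{\delta}+\frac{x'}{\delta'}\right)\right)$, $\mathbb{N}(c)$ for the absolute norm of the ideal $(c)$, $\phi(c)=\#(\mathcal{O}/c)^{\times}$, and $\mu$ for the Möbius function on ideals of $\mathcal{O}$ (so $\mu(p)=-1$ for a prime $p$). Let $p\in\mathcal{O}$ be a prime element not dividing $3$. For $a\in\mathcal{O}$ prime to $p$ let $\left(\frac{a}{p}\right)_3$ be the cubic residue symbol, i.e. the cube root of unity congruent to $a^{(\mathbb{N}(p)-1)/3}$ modulo $p$, put $\left(\frac{a}{p^k}\right)_3=\left(\frac{a}{p}\right)_3^k$, and let $g(1,p)=\sum_{x\,(p)^{*}}\left(\frac{x}{p}\right)_3e\left(\frac{x}{p}\right)$. A star on a summation restricts it to invertible residue classes, and a bar denotes an inverse modulo the denominator of the exponential in which it occurs. Let $w,B\in\mathcal{O}$ with $(wB,p)=1$, let $j,k\ge 1$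 be integers, and put $$S=\sum_{A\,(p^k)^{*}}\left(\frac{A}{p^k}\right)_3e\left(\frac{p^3\,\overline{wA}}{p^k}\right)\sum_{x\,(p^k)}e\left(\frac{Aw^2x^3+p^jBx}{p^k}\right).$$ Then $$S=\begin{cases} \phi(p)\left(\frac{w}{p}\right)_3g(1,p), & k=1,\ j\ge 1,\\ \phi(p^3)\,\mathbb{N}(p)^2, & k=3,\ j\ge 2,\\ \mathbb{N}(p)^5\left[\left(\frac{w}{p}\right)_3g(1,p)\mu(p)+\mathbb{N}(p)\,e\left(\frac{B^3\,\overline{3^3w}}{p}\right)\right], & k=4,\ j=2,\\ \mathbb{N}(p)^5\left[\left(\frac{w}{p}\right)_3g(1,p)\mu(p)+\mathbb{N}(p)\right], & k=4,\ j\ge 3,\\ \mathbb{N}(p)^{k+2}\,e\left(\frac{B^3\,\overline{3^3w}}{p^{k-3}}\right), & k\ge 5,\ j=2, \end{cases}$$ $S$ is nonzero in each of these cases, and $S=0$ for all other $j,k\ge 1$. -/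

import Mathlib

open NumberField

noncomputable section

variable {K : Type*} [Field K] [NumberField K]

/-- `N(c)`, the absolute norm of the ideal generated by `c`. -/
def eisNorm (c : 𝓞 K) : ℕ := Ideal.absNorm (Ideal.span {c})

/-- Euler's function of `c`: the number of invertible residue classes modulo `c`. -/
def eisPhi (c : 𝓞 K) : ℕ := Nat.card (𝓞 K ⧸ Ideal.span {c})ˣ

open Classical in
/-- The Moebius function of the ideal generated by `c`. -/
def eisMoebius (c : 𝓞 K) : ℤ :=
  if Squarefree (Ideal.span {c}) then
    (-1) ^ Multiset.card (UniqueFactorizationMonoid.normalizedFactors (Ideal.span {c}))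
  else 0

/-- The exponential `e(x) = exp (2 π i (x / δ + x' / δ'))`, where `K` is embedded in `ℂ` by `φ`.
For an imaginary quadratic field the nontrivial automorphism `x ↦ x'` is complex conjugation. -/
def eisExp (φ : K →+* ℂ) (δ x : K) : ℂ :=
  Complex.exp (2 * Real.pi * Complex.I * (φ (x / δ) + starRingEnd ℂ (φ (x / δ))))

/-- `e(a / c)` for a residue class `a` modulo `c`; see `eisExpMod_mk` for the independence of the
chosen representative. -/
def eisExpMod (φ : K →+* ℂ) (δ : K) (c : 𝓞 K) (a : 𝓞 K ⧸ Ideal.span {c}) : ℂ :=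
  eisExp φ δ ((Quotient.out a : 𝓞 K) / (c : K))

open Classical in
/-- The cubic residue symbol `(a / p)_3` for a prime `p` not dividing `3`: the cube root of unity
congruent to `a ^ ((N(p) - 1) / 3)` modulo `p`, and `0` when `p ∣ a`. -/
def cubicSymbol (φ : K →+* ℂ) (p a : 𝓞 K) : ℂ :=
  if h : ∃ ζ : 𝓞 K, ζ ^ 3 = 1 ∧ p ∣ a ^ ((eisNorm p - 1) / 3) - ζ then φ (h.choose : K) else 0

/-- The cubic residue symbol `(a / p ^ k)_3 = (a / p)_3 ^ k`, for a residue class `a` modulo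
`p ^ k` with `1 ≤ k`. By `cubicSymbol_congr` it does not depend on the representative. -/
def cubicSymbolPow (φ : K →+* ℂ) (p : 𝓞 K) (k : ℕ) (a : 𝓞 K ⧸ Ideal.span {p ^ k}) : ℂ :=
  cubicSymbol φ p (Quotient.out a : 𝓞 K) ^ k

/-- The cubic Gauss sum `g(1, p) = ∑_{x mod p, (x, p) = 1} (x / p)_3 e(x / p)`. -/
def cubicGauss (φ : K →+* ℂ) (δ : K) (p : 𝓞 K) : ℂ :=
  ∑ᶠ x : (𝓞 K ⧸ Ideal.span {p})ˣ,
    cubicSymbol φ p (Quotient.out (x : 𝓞 K ⧸ Ideal.span {p}) : 𝓞 K) * eisExpMod φ δ p x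

/-- The sum `∑_{A mod p ^ k, (A, p) = 1} (A / p ^ k)_3 e(b (wA)⁻¹ / p ^ k)
∑_{x mod p ^ k} e((A w² x³ + p ^ j B x) / p ^ k)`, where the inverse is taken modulo `p ^ k`. -/
def twistedCubicSum (φ : K →+* ℂ) (δ : K) (p b w B : 𝓞 K) (j k : ℕ) : ℂ :=
  let π := Ideal.Quotient.mk (Ideal.span {p ^ k})
  ∑ᶠ A : (𝓞 K ⧸ Ideal.span {p ^ k})ˣ,
    cubicSymbolPow φ p k A * eisExpMod φ δ (p ^ k) (π b * Ring.inverse (π w * A)) *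
      ∑ᶠ x : 𝓞 K ⧸ Ideal.span {p ^ k},
        eisExpMod φ δ (p ^ k) (A * π w ^ 2 * x ^ 3 + π p ^ j * π B * x)

/-- `e(B³ (3³ w)⁻¹ / c)`, where the inverse is taken modulo `c`. -/
def cubePhase (φ : K →+* ℂ) (δ : K) (c w B : 𝓞 K) : ℂ :=
  let π := Ideal.Quotient.mk (Ideal.span {c})
  eisExpMod φ δ c (π B ^ 3 * Ring.inverse (3 ^ 3 * π w))

theorem cubicSymbol_congr (φ : K →+* ℂ) {p a a' : 𝓞 K} (h : p ∣ a - a') :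
    cubicSymbol φ p a = cubicSymbol φ p a' := by
  have key : ∀ ζ : 𝓞 K,
      p ∣ a ^ ((eisNorm p - 1) / 3) - ζ ↔ p ∣ a' ^ ((eisNorm p - 1) / 3) - ζ := by
    intro ζ
    have h2 := h.trans (sub_dvd_pow_sub_pow a a' ((eisNorm p - 1) / 3))
    have h3 := dvd_iff_dvd_of_dvd_sub
      (a := p) (b := a ^ ((eisNorm p - 1) / 3) - ζ) (c := a' ^ ((eisNorm p - 1) / 3) - ζ)
      (by simpa using h2)
    exact h3
  classical
  exact congrArg (fun P : 𝓞 K → Prop =>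
    if h : ∃ ζ : 𝓞 K, ζ ^ 3 = 1 ∧ P ζ then φ (h.choose : K) else 0)
    (funext fun ζ => propext (key ζ))

theorem cubicSymbol_eq (φ : K →+* ℂ) {p a ζ : 𝓞 K} (hp3 : ¬ p ∣ 3)
    (hζ : ζ ^ 3 = 1) (h : p ∣ a ^ ((eisNorm p - 1) / 3) - ζ) :
    cubicSymbol φ p a = φ (ζ : K) := by
  have hex : ∃ ζ : 𝓞 K, ζ ^ 3 = 1 ∧ p ∣ a ^ ((eisNorm p - 1) / 3) - ζ := ⟨ζ, hζ, h⟩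
  rw [cubicSymbol, dif_pos hex]
  obtain ⟨h1, h2⟩ := hex.choose_spec
  set ξ := hex.choose
  have hd : p ∣ ζ - ξ := by
    have := dvd_sub h2 h
    rwa [sub_sub_sub_cancel_left] at this
  suffices hs : ζ - ξ = 0 by rw [sub_eq_zero.mp hs]
  by_contra hne
  have hq : ζ ^ 2 + ζ * ξ + ξ ^ 2 = 0 := by
    refine (mul_eq_zero.mp ?_).resolve_left hne
    linear_combination hζ - h1
  obtain ⟨c, hc⟩ := hd
  apply hp3
  refine ⟨-(c * (ζ + 2 * ξ)) * ξ, ?_⟩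
  linear_combination (-3 : 𝓞 K) * h1 + ξ * hq - ξ * (ζ + 2 * ξ) * hc

theorem eta_relation {L : Type*} [Field L] {ζ : L} (h : IsPrimitiveRoot ζ 3) : ζ ^ 2 + ζ + 1 = 0 := by
  have h1 : ζ - 1 ≠ 0 := sub_ne_zero.mpr (h.ne_one (by norm_num))
  refine (mul_eq_zero.mp ?_).resolve_left h1
  linear_combination h.pow_eq_one

theorem exists_cubicSymbol [IsCyclotomicExtension {3} ℚ K] {p a : 𝓞 K} (hp : Prime p)
    (hp3 : ¬ p ∣ 3) (ha : ¬ p ∣ a) :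
    ∃ ζ : 𝓞 K, ζ ^ 3 = 1 ∧ p ∣ a ^ ((eisNorm p - 1) / 3) - ζ := by
  obtain ⟨η, hη⟩ : ∃ η : 𝓞 K, η ^ 2 + η + 1 = 0 := by
    have h := IsCyclotomicExtension.zeta_spec 3 ℚ K
    refine ⟨h.toInteger, ?_⟩
    apply RingOfIntegers.ext
    have h1 : (h.toInteger : K) = IsCyclotomicExtension.zeta 3 ℚ K := h.coe_toInteger
    simpa [h1] using eta_relation h
  have hη3 : η ^ 3 = 1 := by linear_combination (η - 1) * hη
  have hprime : (Ideal.span {p}).IsPrime := (Ideal.span_singleton_prime hp.ne_zero).mpr hp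
  have hbot : Ideal.span {p} ≠ ⊥ := by simpa using hp.ne_zero
  have hmax : (Ideal.span {p}).IsMaximal := hprime.isMaximal hbot
  let _ := Ideal.Quotient.field (Ideal.span {p})
  have : Finite (𝓞 K ⧸ Ideal.span {p}) := Ideal.finiteQuotientOfFreeOfNeBot _ hbot
  let _ := Fintype.ofFinite (𝓞 K ⧸ Ideal.span {p})
  let π := Ideal.Quotient.mk (Ideal.span {p})
  have hπ : ∀ x, π x = 0 ↔ p ∣ x := fun x => by
    rw [Ideal.Quotient.eq_zero_iff_mem, Ideal.mem_span_singleton]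
  have hcard : Fintype.card (𝓞 K ⧸ Ideal.span {p}) = eisNorm p := by
    rw [← Nat.card_eq_fintype_card, eisNorm, Ideal.absNorm_apply, Submodule.cardQuot_apply]
  have hη1 : π η ≠ 1 := by
    intro h1
    apply hp3
    rw [← hπ]
    have := congrArg π hη
    simp only [map_add, map_pow, map_one, map_zero, h1] at this
    rw [map_ofNat]
    linear_combination this
  have hord : orderOf (π η) = 3 := by
    have : Fact (Nat.Prime 3) := ⟨Nat.prime_three⟩
    exact orderOf_eq_prime (by rw [← map_pow, hη3, map_one]) hη1
  have h3 : 3 ∣ eisNorm p - 1 := by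
    rw [← hord, ← hcard]
    apply orderOf_dvd_of_pow_eq_one
    apply FiniteField.pow_card_sub_one_eq_one
    intro h0
    have := congrArg π hη3
    rw [map_pow, h0] at this
    simp at this
  have hpow : π (a ^ ((eisNorm p - 1) / 3)) ^ 3 = 1 := by
    rw [map_pow, ← pow_mul, Nat.div_mul_cancel h3, ← hcard]
    exact FiniteField.pow_card_sub_one_eq_one _ (by rwa [Ne, hπ])
  set b := a ^ ((eisNorm p - 1) / 3)
  have hd : p ∣ (b - 1) * ((b - η) * (b - η ^ 2)) := by
    rw [← hπ]
    have : (b - 1) * ((b - η) * (b - η ^ 2)) = b ^ 3 - 1 := by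
      linear_combination (-(b - 1) * b) * hη + (b - 1) * hη3
    rw [this, map_sub, map_pow, hpow, map_one, sub_self]
  rcases hp.dvd_or_dvd hd with h | h
  · exact ⟨1, one_pow 3, h⟩
  rcases hp.dvd_or_dvd h with h | h
  · exact ⟨η, hη3, h⟩
  · exact ⟨η ^ 2, by rw [← pow_mul, mul_comm, pow_mul, hη3, one_pow], h⟩

theorem eisExp_add (φ : K →+* ℂ) (δ x y : K) :
    eisExp φ δ (x + y) = eisExp φ δ x * eisExp φ δ y := by
  rw [eisExp, eisExp, eisExp, ← Complex.exp_add]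
  congr 1
  simp only [add_div, map_add]
  ring

theorem eisExp_integer [IsCyclotomicExtension {3} ℚ K] (φ : K →+* ℂ) {δ : K} (hδ : δ ^ 2 = -3)
    (x : 𝓞 K) : eisExp φ δ (x : K) = 1 := by
  have hζ := IsCyclotomicExtension.zeta_spec 3 ℚ K
  set ζ := IsCyclotomicExtension.zeta 3 ℚ K
  have hq : ζ ^ 2 + ζ + 1 = 0 := eta_relation hζ
  obtain ⟨a, b, hab⟩ : ∃ a b : ℤ, (x : K) = a + b * ζ := by
    have hx : (x : K) ∈ Algebra.adjoin ℤ {ζ} := by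
      have := IsCyclotomicExtension.Rat.isIntegralClosure_adjoin_singleton_of_prime (p := 3) hζ
      obtain ⟨y, hy⟩ := this.isIntegral_iff.mp (RingOfIntegers.isIntegral_coe x)
      have hy' : (y : K) = (x : K) := hy
      rw [← hy']
      exact y.2
    generalize (x : K) = x' at hx
    induction hx using Algebra.adjoin_induction with
    | mem y hy => exact ⟨0, 1, by simpa using hy⟩
    | algebraMap r => exact ⟨r, 0, by simp⟩
    | add y z _ _ hy hz =>
      obtain ⟨a, b, h1⟩ := hy
      obtain ⟨c, d, h2⟩ := hz
      exact ⟨a + c, b + d, by rw [h1, h2]; push_cast; ring⟩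
    | mul y z _ _ hy hz =>
      obtain ⟨a, b, h1⟩ := hy
      obtain ⟨c, d, h2⟩ := hz
      refine ⟨a * c - b * d, a * d + b * c - b * d, ?_⟩
      rw [h1, h2]
      push_cast
      linear_combination (b * d : K) * hq
  have hδ0 : φ δ ≠ 0 := by
    rw [map_ne_zero]
    rintro rfl
    norm_num at hδ
  have hz3 : φ ζ ^ 3 = 1 := by rw [← map_pow, hζ.pow_eq_one, map_one]
  have hz2 : φ ζ ^ 2 + φ ζ + 1 = 0 := by
    have := congrArg φ hq
    simpa using this
  have hn : ‖φ ζ‖ = 1 := Complex.norm_eq_one_of_pow_eq_one hz3 (by norm_num)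
  have hc : starRingEnd ℂ (φ ζ) = -1 - φ ζ := by
    have h1 : φ ζ * starRingEnd ℂ (φ ζ) = 1 := by
      rw [Complex.mul_conj, Complex.normSq_eq_norm_sq, hn]; norm_num
    linear_combination (φ ζ) ^ 2 * h1 + (-starRingEnd ℂ (φ ζ)) * hz3 + hz2
  obtain hs | hs : φ δ = 2 * φ ζ + 1 ∨ φ δ = -(2 * φ ζ + 1) := by
    apply sq_eq_sq_iff_eq_or_eq_neg.mp
    rw [← map_pow, hδ, map_neg, map_ofNat]
    linear_combination (-4 : ℂ) * hz2
  · have hne : 2 * φ ζ + 1 ≠ 0 := hs ▸ hδ0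
    have he : 2 * (-1 - φ ζ) + 1 = -(2 * φ ζ + 1) := by ring
    have : φ ((x : K) / δ) + starRingEnd ℂ (φ ((x : K) / δ)) = (b : ℤ) := by
      rw [hab]
      simp only [map_div₀, map_add, map_mul, map_intCast, hs, hc, map_ofNat, map_one, he, div_neg]
      simp only [div_eq_mul_inv]
      linear_combination (b : ℂ) * mul_inv_cancel₀ hne
    rw [eisExp, this, mul_comm]
    exact Complex.exp_int_mul_two_pi_mul_I b
  · have hne : 2 * φ ζ + 1 ≠ 0 := by
      intro h; apply hδ0; rw [hs, h, neg_zero]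
    have he : 2 * (-1 - φ ζ) + 1 = -(2 * φ ζ + 1) := by ring
    have : φ ((x : K) / δ) + starRingEnd ℂ (φ ((x : K) / δ)) = ((-b : ℤ) : ℂ) := by
      rw [hab]
      simp only [map_div₀, map_add, map_mul, map_neg, map_intCast, hs, hc, map_ofNat, map_one, he, neg_neg, div_neg, map_neg]
      simp only [div_eq_mul_inv]
      push_cast
      linear_combination (-b : ℂ) * mul_inv_cancel₀ hne
    rw [eisExp, this, mul_comm]
    exact Complex.exp_int_mul_two_pi_mul_I (-b)

theorem eisExpMod_mk [IsCyclotomicExtension {3} ℚ K] (φ : K →+* ℂ) {δ : K} (hδ : δ ^ 2 = -3)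
    {c : 𝓞 K} (hc : c ≠ 0) (a : 𝓞 K) :
    eisExpMod φ δ c (Ideal.Quotient.mk _ a) = eisExp φ δ ((a : K) / (c : K)) := by
  set r : 𝓞 K := Quotient.out (Ideal.Quotient.mk (Ideal.span {c}) a) with hr
  have h1 : Ideal.Quotient.mk (Ideal.span {c}) r = Ideal.Quotient.mk _ a := Quotient.out_eq _
  rw [Ideal.Quotient.eq, Ideal.mem_span_singleton] at h1
  obtain ⟨d, hd⟩ := h1
  have hcK : (c : K) ≠ 0 := by simpa using hc
  have h2 : (r : K) / (c : K) = (a : K) / (c : K) + (d : K) := by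
    have h3 : (r : K) - a = c * d := by
      have := congrArg (algebraMap (𝓞 K) K) hd
      simpa using this
    field_simp
    linear_combination h3
  change eisExp φ δ ((r : K) / (c : K)) = _
  rw [h2, eisExp_add, eisExp_integer φ hδ, mul_one]

end

open NumberField

/-! ### Cubic characters of a finite field -/

noncomputable section

/-! Let R = 𝒪/p^k, F = 𝒪/p, q = N(p), ψ(x) = e(x/p^k), and let χ be the cubic symbol on F. For k ≥ 2
the coefficient of x in the inner sum is divisible by p, so translating x by multiples of p^(k-1)
shows that only x divisible by p contribute. Hence q S = ∑_A ∑_x χ(A)^k ψ(p³((wA)⁻¹ + A w² x³) +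
p^(j+1) B x) (`card_mul_truncatedCubicSum`), and the cases reflect how much of this phase survives
modulo p^k. For k = 2 it is trivial and ∑ χ² = 0; for k = 3, j ≥ 2 it is trivial and χ³ = 1 on
units; for j = 1, k ≥ 3 the linear term alone forces cancellation. The case k = 1 is a direct Gauss
sum computation.

For k = 4, j ≥ 2 the phase lives on F (`sum_kloosterman_cubic`). When x ≠ 0 the A-sum is a
Kloosterman sum twisted by χ, and the Duke–Iwaniec identity (`sum_addChar_cubic_eq_kloosterman`)
rewrites it as ∑_y ψ'(y³/w - 3xy), with ψ'(x) = e(x/p). Orthogonality in x then leaves the single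
term y = b/3, b being the linear coefficient, and the failure of the identity at x = 0 produces the
Gauss sum term.

For k ≥ 5, j ≥ 2 the method is stationary phase (`sum_eq_sum_filter_of_shift`). With j ≥ 3 there is
no critical point. With j = 2 a rescaling brings the phase to v(3ξ - αξ³ - α⁻¹), whose only critical
point is (1, 1). Its Hessian form has discriminant -3, a square in R, so the quadratic sum is an
exact power of q.

Nonvanishing follows from |g(1,p)|² = q, which makes the two terms for k = 4 differ in size. -/

theorem MulChar.apply_pow_three {F : Type*} [Field F] {χ : MulChar F ℂ} (hχ : χ ^ 3 = 1)
    {a : F} (ha : a ≠ 0) : χ a ^ 3 = 1 := by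
  rw [← MulChar.pow_apply' _ (by norm_num), hχ, MulChar.one_apply (Ne.isUnit ha)]

/-- The value of χ at a generator γ of the cyclic group of units has order exactly 3, since χ ≠ 1;
so χ(γ^n) = 1 forces 3 ∣ n. -/
theorem MulChar.eq_one_iff_exists_cube {F : Type*} [Field F] [Finite F] {χ : MulChar F ℂ}
    (hχ : χ ^ 3 = 1) (hχ1 : χ ≠ 1) {a : F} (ha : a ≠ 0) : χ a = 1 ↔ ∃ b, b ^ 3 = a := by
  constructor
  · intro h
    obtain ⟨γ, hγ⟩ := IsCyclic.exists_generator (α := Fˣ)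
    have hγ1 : χ γ ≠ 1 := by
      intro h1
      apply hχ1
      ext u
      obtain ⟨n, rfl⟩ := hγ u
      rw [MulChar.one_apply_coe]
      have : MulChar.toUnitHom χ γ = 1 := by ext; simpa using h1
      have h2 : MulChar.toUnitHom χ (γ ^ n) = 1 := by rw [map_zpow, this, one_zpow]
      simpa only [MulChar.coe_toUnitHom, Units.val_one] using congrArg Units.val h2
    obtain ⟨n, hn⟩ := (Submonoid.mem_powers_iff _ _).mp
      ((mem_powers_iff_mem_zpowers).mpr (hγ (Units.mk0 a ha)))
    have han : a = (γ : F) ^ n := by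
      have := congrArg Units.val hn
      simpa using this.symm
    have h3 : χ γ ^ n = 1 := by rw [← map_pow, ← han, h]
    have h4 : χ γ ^ 3 = 1 := apply_pow_three hχ γ.ne_zero
    have : Fact (Nat.Prime 3) := ⟨Nat.prime_three⟩
    have hord : orderOf (χ γ) = 3 := orderOf_eq_prime h4 hγ1
    obtain ⟨m, rfl⟩ : 3 ∣ n := hord ▸ orderOf_dvd_of_pow_eq_one h3
    exact ⟨(γ : F) ^ m, by rw [han]; ring⟩
  · rintro ⟨b, rfl⟩
    rw [map_pow]
    exact apply_pow_three hχ (by rintro rfl; simp at ha)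

theorem MulChar.apply_pow_three_mul {F : Type*} [Field F] {χ : MulChar F ℂ} (hχ : χ ^ 3 = 1) {a b : F} (ha : a ≠ 0) :
    χ (a ^ 3 * b) = χ b := by
  rw [map_mul, map_pow, apply_pow_three hχ ha, one_mul]

theorem MulChar.sum_sq_eq_zero {F : Type*} [Field F] [Fintype F] {χ : MulChar F ℂ} (hχ : χ ^ 3 = 1) (hχ1 : χ ≠ 1) : ∑ a : F, χ a ^ 2 = 0 := by
  have h : χ ^ 2 ≠ 1 := by
    intro h
    apply hχ1
    rw [← hχ, pow_succ, h, one_mul]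
  rw [← MulChar.sum_eq_zero_of_ne_one h]
  exact Finset.sum_congr rfl fun a _ => (MulChar.pow_apply' _ (by norm_num) _).symm

theorem add_div_eq_add_div_iff {F : Type*} [Field F] {c A A' : F} (hA : A ≠ 0) (hA' : A' ≠ 0) :
    A' + c / A' = A + c / A ↔ A' = A ∨ A' = c / A := by
  rw [eq_div_iff hA, ← sub_eq_zero (a := A'), ← sub_eq_zero (b := c), ← mul_eq_zero, ← sub_eq_zero]
  constructor
  · intro h
    field_simp at h
    linear_combination h
  · intro h
    field_simp
    linear_combination h

theorem sum_mulChar_mul_comp_mul_left {F : Type*} [Field F] [Fintype F] (χ : MulChar F ℂ) {a : F} (ha : a ≠ 0) (f : F → ℂ) :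
    ∑ A : F, χ A * f A = χ a * ∑ A : F, χ A * f (a * A) := by
  rw [← Equiv.sum_comp (Equiv.mulLeft₀ a ha), Finset.mul_sum]
  simp [mul_assoc]

/-! ### The Duke–Iwaniec identity and the mixed sum over a finite field -/

section Field

variable {F : Type*} [Field F] [Fintype F] [DecidableEq F] {χ : MulChar F ℂ} {ω : F}

theorem card_cube_roots (hχ : χ ^ 3 = 1) (hχ1 : χ ≠ 1) (hω : ω ^ 2 + ω + 1 = 0)
    (h3 : (3 : F) ≠ 0) (t : F) :
    ((Finset.univ.filter fun y : F => y ^ 3 = t).card : ℂ) = 1 + χ t + χ t ^ 2 := by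
  rcases eq_or_ne t 0 with rfl | ht
  · have : (Finset.univ.filter fun y : F => y ^ 3 = 0) = {0} := by ext; simp
    rw [this, MulChar.map_zero]; simp
  by_cases h : ∃ b, b ^ 3 = t
  · rw [(MulChar.eq_one_iff_exists_cube hχ hχ1 ht).mpr h]
    obtain ⟨b, rfl⟩ := h
    have hb : b ≠ 0 := by rintro rfl; simp at ht
    have hω1 : ω ≠ 1 := by rintro rfl; apply h3; linear_combination hω
    have hω2 : ω ^ 2 ≠ 1 := by
      intro h; apply h3; linear_combination h - (ω - 2) * (hω - h)
    have hω0 : ω ≠ 0 := by rintro rfl; simp at hω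
    have : (Finset.univ.filter fun y : F => y ^ 3 = b ^ 3) = {b, b * ω, b * ω ^ 2} := by
      ext y
      simp only [Finset.mem_filter_univ, Finset.mem_insert, Finset.mem_singleton]
      have hf : y ^ 3 - b ^ 3 = (y - b) * ((y - b * ω) * (y - b * ω ^ 2)) := by
        linear_combination ((y - b) * (y * b - b ^ 2 * (ω - 1))) * hω
      rw [← sub_eq_zero, hf]
      simp only [mul_eq_zero, sub_eq_zero]
    rw [this, Finset.card_eq_three.mpr ⟨b, b * ω, b * ω ^ 2, ?_, ?_, ?_, rfl⟩]
    · norm_num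
    · intro h; exact hω1 (mul_left_cancel₀ hb (by linear_combination -h))
    · intro h; exact hω2 (mul_left_cancel₀ hb (by linear_combination -h))
    · intro h
      exact hω1 (mul_left_cancel₀ (mul_ne_zero hb hω0) (by linear_combination -h))
  · have : (Finset.univ.filter fun y : F => y ^ 3 = t) = ∅ := by
      ext y; simpa using fun hy => h ⟨y, hy⟩
    rw [this]
    have h1 : χ t - 1 ≠ 0 := by
      rw [Ne, sub_eq_zero, MulChar.eq_one_iff_exists_cube hχ hχ1 ht]; exact h
    have h2 := MulChar.apply_pow_three hχ ht
    symm
    refine (mul_eq_zero.mp ?_).resolve_left h1 |>.trans (by simp)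
    linear_combination h2


theorem sum_fiber_sum_mul_self {α β : Type*} [Fintype α] [Fintype β] [DecidableEq β] (f : α → β)
    (g : α → ℂ) :
    ∑ s, (∑ b with f b = s, g b) ^ 2 = ∑ b, g b * ∑ b' with f b' = f b, g b' := by
  rw [← Finset.sum_fiberwise Finset.univ f]
  refine Finset.sum_congr rfl fun s _ => ?_
  rw [sq, Finset.sum_mul]
  refine Finset.sum_congr rfl fun b hb => ?_
  rw [(Finset.mem_filter_univ _).mp hb]

/-- The form splits as (b - ωb')(b - ω²b') over F, so the curve is a hyperbola with q - 1 points. -/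
theorem sum_card_norm_form_eq (hω : ω ^ 2 + ω + 1 = 0) (h3 : (3 : F) ≠ 0) {c : F} (hc : c ≠ 0) :
    ∑ b : F, ((Finset.univ.filter fun b' : F => b ^ 2 + b * b' + b' ^ 2 = c).card : ℂ) =
      Fintype.card F - 1 := by
  have hωω : ω - ω ^ 2 ≠ 0 := by
    intro h
    apply h3
    linear_combination (ω ^ 2 - 3 * ω + 3) * hω - (ω - ω ^ 2) * h
  simp only [← Finset.sum_boole]
  have h1 : ∀ b b' : F, b ^ 2 + b * b' + b' ^ 2 = (b - ω * b') * (b - ω ^ 2 * b') := by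
    intro b b'
    linear_combination (b * b' - b' ^ 2 * (ω - 1)) * hω
  simp only [h1]
  rw [Finset.sum_comm]
  have h2 : ∀ b' : F, (∑ b : F, if (b - ω * b') * (b - ω ^ 2 * b') = c then (1 : ℂ) else 0) =
      ∑ b : F, if b * (b + (ω - ω ^ 2) * b') = c then 1 else 0 := by
    intro b'
    rw [← Equiv.sum_comp (Equiv.addRight (ω * b'))]
    refine Finset.sum_congr rfl fun b _ => ?_
    simp only [Equiv.coe_addRight]
    congr 2
    ring
  rw [Finset.sum_congr rfl fun b' _ => h2 b', Finset.sum_comm]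
  have h3 : ∀ b : F, (∑ b' : F, if b * (b + (ω - ω ^ 2) * b') = c then (1 : ℂ) else 0) =
      1 - if b = 0 then 1 else 0 := by
    intro b
    by_cases hb : b = 0
    · simp [hb, hc.symm]
    · have : ∀ b' : F, b * (b + (ω - ω ^ 2) * b') = c ↔ b' = (c / b - b) / (ω - ω ^ 2) := by
        intro b'
        rw [eq_div_iff hωω, eq_sub_iff_add_eq, eq_div_iff hb]
        constructor <;> intro h <;> linear_combination h
      simp [this, hb]
  rw [Finset.sum_congr rfl fun b _ => h3 b]
  simp

/-- The number of `b` with `b ^ 3 / c - 3 * b = s`. -/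
def cubicFiberCard (c s : F) : ℕ := (Finset.univ.filter fun b : F => b ^ 3 / c - 3 * b = s).card

/-- The second moment counts pairs (b, b') in a common fibre. These lie on the diagonal or on b² +
bb' + b'² = 3c, and the two curves meet where b² = c. -/
theorem sum_cubicFiberCard_sq (hω : ω ^ 2 + ω + 1 = 0) (h3 : (3 : F) ≠ 0) {c : F} (hc : c ≠ 0) :
    ∑ s : F, (cubicFiberCard c s : ℂ) ^ 2 =
      2 * Fintype.card F - 1 - (Finset.univ.filter fun b : F => b ^ 2 = c).card := by
  have h1 := sum_fiber_sum_mul_self (fun b : F => b ^ 3 / c - 3 * b) (fun _ => 1)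
  simp only [Finset.sum_const, nsmul_eq_mul, mul_one, one_mul] at h1
  simp only [cubicFiberCard]
  rw [h1]
  have h2 : ∀ b : F, ((Finset.univ.filter fun b' : F =>
      b' ^ 3 / c - 3 * b' = b ^ 3 / c - 3 * b).card : ℂ) =
      1 + (Finset.univ.filter fun b' : F => b ^ 2 + b * b' + b' ^ 2 = 3 * c).card -
        if b ^ 2 = c then 1 else 0 := by
    intro b
    have h4 : ∀ b' : F, b' ^ 3 / c - 3 * b' = b ^ 3 / c - 3 * b ↔
        b' = b ∨ b ^ 2 + b * b' + b' ^ 2 = 3 * c := by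
      intro b'
      rw [← sub_eq_zero (a := b'), ← sub_eq_zero (b := 3 * c), ← mul_eq_zero, ← sub_eq_zero]
      constructor
      · intro h
        field_simp at h
        linear_combination h
      · intro h
        field_simp
        linear_combination h
    have h5 : b ^ 2 = c ↔ b ^ 2 + b * b + b ^ 2 = 3 * c := by
      constructor
      · intro h; linear_combination 3 * h
      · intro h; exact mul_left_cancel₀ h3 (by linear_combination h)
    simp only [h4, Finset.filter_or, Finset.filter_eq', Finset.mem_univ, if_true]
    by_cases hb : b ^ 2 = c
    · rw [if_pos hb, Finset.union_eq_right.mpr]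
      · ring
      · simpa using h5.mp hb
    · rw [if_neg hb, Finset.card_union_of_disjoint]
      · simp
      · simpa using fun h => hb (h5.mpr h)
  simp only [h2, Finset.sum_sub_distrib, Finset.sum_add_distrib]
  rw [sum_card_norm_form_eq hω h3 (mul_ne_zero h3 hc), Finset.sum_boole]
  simp
  ring

/-- The sum of `χ (c * A)` over the roots `A` of `A + c / A = s`. -/
def quadraticFiberSum (χ : MulChar F ℂ) (c s : F) : ℂ := ∑ A with A + c / A = s, χ (c * A)

theorem quadraticFiberSum_add_div (χ : MulChar F ℂ) {c A : F} (hA : A ≠ 0) :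
    quadraticFiberSum χ c (A + c / A) =
      χ (c * A) + χ (c * (c / A)) - if A ^ 2 = c then χ (c * A) else 0 := by
  have h0 : ∀ A' : F, (if A' + c / A' = A + c / A then χ (c * A') else 0) =
      if A' = A ∨ A' = c / A then χ (c * A') else 0 := by
    intro A'
    rcases eq_or_ne A' 0 with rfl | h
    · simp [MulChar.map_zero]
    · simp only [add_div_eq_add_div_iff hA h]
  rw [quadraticFiberSum, Finset.sum_filter, Finset.sum_congr rfl fun A' _ => h0 A',
    ← Finset.sum_filter, Finset.filter_or]
  simp only [Finset.filter_eq', Finset.mem_univ, if_true]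
  have h5 : A ^ 2 = c ↔ A = c / A := by rw [eq_div_iff hA, sq]
  by_cases hb : A ^ 2 = c
  · rw [if_pos hb, ← h5.mp hb]; simp
  · rw [if_neg hb, Finset.sum_union]
    · simp
    · simpa using fun h => hb (h5.mpr h)

/-- A fibre is a pair {A, c/A}. The cross term χ(cA)χ(c·c/A) = χ(c³) is 1, the terms χ(cA)² cancel
because χ² ≠ 1, and a double root A² = c is counted once, with χ(cA) = χ(A³) = 1. -/
theorem sum_quadraticFiberSum_sq (hχ : χ ^ 3 = 1) (hχ1 : χ ≠ 1) {c : F} (hc : c ≠ 0) :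
    ∑ s : F, quadraticFiberSum χ c s ^ 2 =
      Fintype.card F - 1 - (Finset.univ.filter fun b : F => b ^ 2 = c).card := by
  have h1 := sum_fiber_sum_mul_self (fun A : F => A + c / A) (fun A => χ (c * A))
  have h2 : ∀ A : F, χ (c * A) * quadraticFiberSum χ c (A + c / A) =
      χ c ^ 2 * χ A ^ 2 + (1 - if A = 0 then 1 else 0) - if A ^ 2 = c then 1 else 0 := by
    intro A
    rcases eq_or_ne A 0 with rfl | hA
    · simp [hc.symm, MulChar.map_zero]
    · rw [quadraticFiberSum_add_div χ hA]
      have h4 : χ (c * A) * χ (c * (c / A)) = 1 := by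
        rw [← map_mul, show c * A * (c * (c / A)) = c ^ 3 by field_simp, map_pow,
          MulChar.apply_pow_three hχ hc]
      rw [if_neg hA, mul_sub, mul_add, h4, map_mul]
      by_cases hb : A ^ 2 = c
      · rw [if_pos hb, if_pos hb]
        have : χ c * χ A = 1 := by
          rw [← map_mul, ← hb, show A ^ 2 * A = A ^ 3 by ring, map_pow,
            MulChar.apply_pow_three hχ hA]
        linear_combination (-χ c * χ A - 1) * this
      · rw [if_neg hb, if_neg hb]
        ring
  have h3 : ∑ s : F, quadraticFiberSum χ c s ^ 2 =
      ∑ A, χ (c * A) * quadraticFiberSum χ c (A + c / A) := h1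
  rw [h3, Finset.sum_congr rfl fun A _ => h2 A]
  simp only [Finset.sum_sub_distrib, Finset.sum_add_distrib, ← Finset.mul_sum,
    MulChar.sum_sq_eq_zero hχ hχ1, Finset.sum_boole]
  simp [Finset.filter_eq']

/-- This is Cardano's solution: with c = AA', A ≠ A', the cubic is proportional to A(b + A')³ - A'(b
+ A)³, so its roots correspond to the cube roots of A'/A, which χ counts. -/
theorem cubicFiberCard_add_div (hχ : χ ^ 3 = 1) (hχ1 : χ ≠ 1) (hω : ω ^ 2 + ω + 1 = 0)
    (h3 : (3 : F) ≠ 0) {c A : F} (hc : c ≠ 0) (hA : A ≠ 0) :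
    (cubicFiberCard c (A + c / A) : ℂ) - 1 = quadraticFiberSum χ c (A + c / A) := by
  rw [quadraticFiberSum_add_div χ hA]
  obtain ⟨A', hA', rfl⟩ : ∃ A', A' ≠ 0 ∧ c = A * A' :=
    ⟨c / A, div_ne_zero hc hA, by field_simp⟩
  have hdiv : A * A' / A = A' := by field_simp
  have hiff : ∀ b : F, b ^ 3 / (A * A') - 3 * b = A + A' ↔
      b ^ 3 - 3 * (A * A') * b - A * A' * (A + A') = 0 := by
    intro b
    rw [← sub_eq_zero]
    constructor
    · intro h
      field_simp at h
      linear_combination h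
    · intro h
      field_simp
      linear_combination h
  rw [hdiv, cubicFiberCard]
  by_cases hb : A ^ 2 = A * A'
  · obtain rfl : A = A' := mul_left_cancel₀ hA (by rw [← sq, hb])
    rw [if_pos hb]
    -- When A = A' the cubic has the double root -A and the simple root 2A, distinct because 3A ≠ 0.
    have h1 : (Finset.univ.filter fun b : F => b ^ 3 / (A * A) - 3 * b = A + A) = {-A, 2 * A} := by
      ext b
      rw [Finset.mem_filter_univ, hiff, show b ^ 3 - 3 * (A * A) * b - A * A * (A + A) =
        (b - -A) * ((b - -A) * (b - 2 * A)) by ring]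
      simp only [mul_eq_zero, sub_eq_zero, Finset.mem_insert, Finset.mem_singleton]
      tauto
    rw [h1, Finset.card_pair, show A * A * A = A ^ 3 by ring, map_pow,
      MulChar.apply_pow_three hχ hA]
    · norm_num
    · intro h
      exact mul_ne_zero h3 hA (by linear_combination -h)
  · have hne : A ≠ A' := by rintro rfl; exact hb (sq A)
    rw [if_neg hb]
    have h1 : (Finset.univ.filter fun b : F => b ^ 3 / (A * A') - 3 * b = A + A').card =
        (Finset.univ.filter fun M : F => M ^ 3 = A' / A).card := by
      have key : ∀ b : F, b ^ 3 / (A * A') - 3 * b = A + A' ↔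
          A * (b + A') ^ 3 = A' * (b + A) ^ 3 := by
        intro b
        rw [hiff, ← sub_eq_zero (a := A * (b + A') ^ 3)]
        rw [show A * (b + A') ^ 3 - A' * (b + A) ^ 3 =
          (A - A') * (b ^ 3 - 3 * (A * A') * b - A * A' * (A + A')) by ring]
        simp [sub_ne_zero.mpr hne]
      have hbA : ∀ b : F, A * (b + A') ^ 3 = A' * (b + A) ^ 3 → b + A ≠ 0 := by
        intro b h h0
        rw [h0] at h
        simp only [ne_eq, OfNat.ofNat_ne_zero, not_false_eq_true, zero_pow, mul_zero, mul_eq_zero,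
          hA, pow_eq_zero_iff, false_or] at h
        exact hne (by linear_combination h0 - h)
      have hM1 : ∀ M : F, M ^ 3 = A' / A → M - 1 ≠ 0 := by
        intro M h h0
        rw [sub_eq_zero.mp h0, one_pow, eq_div_iff hA] at h
        exact hne (by linear_combination h)
      -- The Möbius map M = (b + A')/(b + A) and its inverse; no denominator vanishes because A ≠
      -- A'.
      refine Finset.card_nbij' (fun b => (b + A') / (b + A)) (fun M => (A' - M * A) / (M - 1))
        ?_ ?_ ?_ ?_
      · intro b h
        simp only [Finset.coe_filter_univ, Set.mem_ofPred_eq, key] at h ⊢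
        have := hbA b h
        field_simp
        linear_combination h
      · intro M h
        simp only [Finset.coe_filter_univ, Set.mem_ofPred_eq, key] at h ⊢
        have h2 := hM1 M h
        rw [eq_div_iff hA] at h
        have h4 : (A' - M * A) / (M - 1) + A' = M * (A' - A) / (M - 1) := by field_simp; ring
        have h5 : (A' - M * A) / (M - 1) + A = (A' - A) / (M - 1) := by field_simp; ring
        rw [h4, h5, div_pow, div_pow, mul_pow, ← h]
        ring
      · intro b h
        simp only [Finset.coe_filter_univ, Set.mem_ofPred_eq, key] at h
        have h2 := hbA b h
        have h4 : A' - A ≠ 0 := sub_ne_zero.mpr hne.symm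
        have h5 : (b + A') / (b + A) - 1 = (A' - A) / (b + A) := by field_simp; ring
        simp only [h5]
        field_simp
        ring
      · intro M h
        simp only [Finset.coe_filter_univ, Set.mem_ofPred_eq] at h
        have h2 := hM1 M h
        have h4 : A' - A ≠ 0 := sub_ne_zero.mpr hne.symm
        have h6 : (A' - M * A) / (M - 1) + A' = M * (A' - A) / (M - 1) := by field_simp; ring
        have h5 : (A' - M * A) / (M - 1) + A = (A' - A) / (M - 1) := by field_simp; ring
        simp only [h5, h6]
        field_simp
    rw [h1, card_cube_roots hχ hχ1 hω h3]
    have h6 : χ (A * A' * A) = χ (A' / A) := by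
      rw [show A * A' * A = A ^ 3 * (A' / A) by field_simp, MulChar.apply_pow_three_mul hχ hA]
    have h7 : χ (A * A' * A') = χ (A' / A) ^ 2 := by
      rw [← map_pow, show A * A' * A' = A ^ 3 * (A' / A) ^ 2 by field_simp,
        MulChar.apply_pow_three_mul hχ hA]
    rw [h6, h7]
    ring

/-- Cardano covers only the set D of those s for which A + c/A = s is solvable in F. Off D the right
side vanishes. Since both sides have the same second moment over all s and agree on D, the squares
of the left side sum to 0 off D, so each of them vanishes. -/
theorem cubicFiberCard_sub_one (hχ : χ ^ 3 = 1) (hχ1 : χ ≠ 1) (hω : ω ^ 2 + ω + 1 = 0)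
    (h3 : (3 : F) ≠ 0) {c : F} (hc : c ≠ 0) (s : F) :
    (cubicFiberCard c s : ℂ) - 1 = quadraticFiberSum χ c s := by
  classical
  let D : F → Prop := fun s => ∃ A, A ≠ 0 ∧ A + c / A = s
  have hD : ∀ s, D s → (cubicFiberCard c s : ℂ) - 1 = quadraticFiberSum χ c s := by
    rintro s ⟨A, hA, rfl⟩
    exact cubicFiberCard_add_div hχ hχ1 hω h3 hc hA
  have hD' : ∀ s, ¬ D s → quadraticFiberSum χ c s = 0 := by
    intro s hs
    refine Finset.sum_eq_zero fun A hA => ?_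
    rw [Finset.mem_filter_univ] at hA
    by_cases h : A = 0
    · simp [h, MulChar.map_zero]
    · exact absurd ⟨A, h, hA⟩ hs
  have hcard : ∑ s : F, (cubicFiberCard c s : ℂ) = Fintype.card F := by
    have := Finset.card_eq_sum_card_fiberwise (s := (Finset.univ : Finset F))
      (t := Finset.univ) (f := fun b : F => b ^ 3 / c - 3 * b) (fun _ _ => Finset.mem_univ _)
    rw [Finset.card_univ] at this
    exact_mod_cast this.symm
  have hsum : ∑ s : F, (((cubicFiberCard c s : ℂ) - 1) ^ 2 - quadraticFiberSum χ c s ^ 2) = 0 := by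
    simp only [sub_sq, Finset.sum_sub_distrib, Finset.sum_add_distrib, mul_one, ← Finset.mul_sum]
    rw [sum_cubicFiberCard_sq hω h3 hc, sum_quadraticFiberSum_sq hχ hχ1 hc, hcard]
    simp
    ring
  -- The identity is moved to ℤ, where squares are nonnegative.
  have hsum2 : ∑ s : F, (if D s then 0 else ((cubicFiberCard c s : ℤ) - 1) ^ 2) = 0 := by
    have : ∑ s : F, (if D s then 0 else ((cubicFiberCard c s : ℂ) - 1) ^ 2) = 0 := by
      refine (Finset.sum_congr rfl fun s _ => ?_).trans hsum
      by_cases hs : D s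
      · rw [if_pos hs, hD s hs, sub_self]
      · rw [if_neg hs, hD' s hs]; simp
    exact_mod_cast this
  by_cases hs : D s
  · exact hD s hs
  · rw [hD' s hs]
    have h0 := (Finset.sum_eq_zero_iff_of_nonneg (fun s _ => by positivity)).mp hsum2 s
      (Finset.mem_univ s)
    rw [if_neg hs] at h0
    have h1 : (cubicFiberCard c s : ℤ) - 1 = 0 := by simpa using h0
    exact_mod_cast h1


/-- The identity of Duke and Iwaniec between cubic exponential sums and Kloosterman sums twisted by
a cubic character. -/
theorem sum_addChar_cubic_eq_kloosterman (hχ : χ ^ 3 = 1) (hχ1 : χ ≠ 1)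
    (hω : ω ^ 2 + ω + 1 = 0) (h3 : (3 : F) ≠ 0) {ψ : AddChar F ℂ} (hψ : ψ ≠ 1) {c : F}
    (hc : c ≠ 0) :
    ∑ b : F, ψ (b ^ 3 / c - 3 * b) = χ c * ∑ A : F, χ A * ψ (A + c / A) := by
  have h1 : ∑ b : F, ψ (b ^ 3 / c - 3 * b) = ∑ s : F, cubicFiberCard c s * ψ s := by
    rw [← Finset.sum_fiberwise Finset.univ fun b : F => b ^ 3 / c - 3 * b]
    refine Finset.sum_congr rfl fun s _ => ?_
    rw [Finset.sum_congr rfl fun b hb => by rw [(Finset.mem_filter_univ _).mp hb]]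
    rw [Finset.sum_const, nsmul_eq_mul, cubicFiberCard]
  have h2 : χ c * ∑ A : F, χ A * ψ (A + c / A) = ∑ s : F, quadraticFiberSum χ c s * ψ s := by
    rw [← Finset.sum_fiberwise Finset.univ fun A : F => A + c / A, Finset.mul_sum]
    refine Finset.sum_congr rfl fun s _ => ?_
    rw [quadraticFiberSum, Finset.sum_mul, Finset.mul_sum]
    refine Finset.sum_congr rfl fun b hb => ?_
    rw [(Finset.mem_filter_univ _).mp hb, map_mul, mul_assoc]
  -- The coefficients of ψ(s) on the two sides differ by 1, and ∑ ψ(s) = 0.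
  rw [h1, h2, ← sub_eq_zero, ← Finset.sum_sub_distrib, ← AddChar.sum_eq_zero_of_ne_one hψ]
  refine Finset.sum_congr rfl fun s _ => ?_
  rw [← cubicFiberCard_sub_one hχ hχ1 hω h3 hc]
  ring

theorem sum_addChar_cube_mul (hχ : χ ^ 3 = 1) (hχ1 : χ ≠ 1) (hω : ω ^ 2 + ω + 1 = 0)
    (h3 : (3 : F) ≠ 0) {ψ : AddChar F ℂ} (hψ : ψ.IsPrimitive) {a : F} (ha : a ≠ 0) :
    ∑ b : F, ψ (a * b ^ 3) = ∑ t : F, χ t * ψ (a * t) + ∑ t : F, χ t ^ 2 * ψ (a * t) := by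
  have h0 : ∑ t : F, ψ (a * t) = 0 := by
    have := AddChar.sum_eq_zero_of_ne_one (hψ ha)
    simpa using this
  rw [← Finset.sum_fiberwise Finset.univ fun b : F => b ^ 3, ← add_zero (_ + _), ← h0,
    ← Finset.sum_add_distrib, ← Finset.sum_add_distrib]
  refine Finset.sum_congr rfl fun s _ => ?_
  rw [Finset.sum_congr rfl fun b hb => by rw [(Finset.mem_filter_univ _).mp hb]]
  rw [Finset.sum_const, nsmul_eq_mul, card_cube_roots hχ hχ1 hω h3]
  ring

/-- The evaluation of the mixed Kloosterman and cubic exponential sum over a finite field. -/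
theorem sum_kloosterman_cubic (hχ : χ ^ 3 = 1) (hχ1 : χ ≠ 1) (hω : ω ^ 2 + ω + 1 = 0)
    (h3 : (3 : F) ≠ 0) {ψ : AddChar F ℂ} (hψ : ψ.IsPrimitive) {w : F} (hw : w ≠ 0) (b : F) :
    ∑ A : F, χ A * (ψ ((w * A)⁻¹) * ∑ x : F, ψ (A * w ^ 2 * x ^ 3 + b * x)) =
      Fintype.card F * ψ (b ^ 3 * (3 ^ 3 * w)⁻¹) - χ w * gaussSum χ ψ := by
  have hψ1 : ψ ≠ 1 := by
    have := hψ (one_ne_zero (α := F))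
    rwa [AddChar.mulShift_one] at this
  -- Replacing A by A/(w²x³) gives the twisted Kloosterman sum with c = wx³; on the cubic side the
  -- variable is b = yx.
  have hinner : ∀ x : F, x ≠ 0 →
      ∑ A : F, χ A * ψ ((w * A)⁻¹ + A * w ^ 2 * x ^ 3) =
        ∑ y : F, ψ (w⁻¹ * y ^ 3 - 3 * (y * x)) := by
    intro x hx
    have hwx : w * x ^ 3 ≠ 0 := by simp [hw, hx]
    have ha : (w ^ 2 * x ^ 3)⁻¹ ≠ 0 := by simp [hw, hx]
    have hχa : χ (w * x ^ 3) = χ (w ^ 2 * x ^ 3)⁻¹ := by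
      rw [← MulChar.apply_pow_three_mul hχ (a := w * x ^ 2) (b := (w ^ 2 * x ^ 3)⁻¹)
        (by simp [hw, hx])]
      congr 1
      field_simp
    rw [sum_mulChar_mul_comp_mul_left χ ha, ← hχa, ← Equiv.sum_comp (Equiv.mulRight₀ x⁻¹
      (inv_ne_zero hx)) fun y => ψ (w⁻¹ * y ^ 3 - 3 * (y * x))]
    refine Eq.trans ?_ ((sum_addChar_cubic_eq_kloosterman hχ hχ1 hω h3 hψ1 hwx).symm.trans ?_)
    · congr 1
      refine Finset.sum_congr rfl fun A _ => ?_
      congr 2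
      rcases eq_or_ne A 0 with rfl | hA
      · simp
      · field_simp
        ring
    · refine Finset.sum_congr rfl fun y _ => ?_
      congr 1
      simp only [Equiv.mulRight₀_apply]
      field_simp
  -- At x = 0 the A-sum is only the χ² part of the cubic sum in `hcube`; the missing χ part is the
  -- term -χ(w)g of the result.
  have hzero : ∑ A : F, χ A * ψ ((w * A)⁻¹ + A * w ^ 2 * 0 ^ 3) =
      ∑ t : F, χ t ^ 2 * ψ (w⁻¹ * t) := by
    rw [← Equiv.sum_comp (Equiv.inv F)]
    refine Finset.sum_congr rfl fun t _ => ?_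
    rcases eq_or_ne t 0 with rfl | ht
    · simp [MulChar.map_zero]
    · have h1 : χ t⁻¹ = χ t ^ 2 := by
        rw [← map_pow, ← MulChar.apply_pow_three_mul hχ ht]
        congr 1
        field_simp
      simp only [Equiv.inv_apply]
      rw [h1]
      congr 2
      field_simp
      ring
  have hgauss : ∑ t : F, χ t * ψ (w⁻¹ * t) = χ w * gaussSum χ ψ := by
    rw [sum_mulChar_mul_comp_mul_left χ hw, gaussSum]
    simp [inv_mul_cancel_left₀ hw]
  have hcube : ∑ y : F, ψ (w⁻¹ * y ^ 3 - 3 * (y * 0)) =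
      χ w * gaussSum χ ψ + ∑ t : F, χ t ^ 2 * ψ (w⁻¹ * t) := by
    rw [← hgauss, ← sum_addChar_cube_mul hχ hχ1 hω h3 hψ (inv_ne_zero hw)]
    simp
  have hfourier : ∑ x : F, ψ (b * x) * ∑ y : F, ψ (w⁻¹ * y ^ 3 - 3 * (y * x)) =
      Fintype.card F * ψ (b ^ 3 * (3 ^ 3 * w)⁻¹) := by
    have h1 : ∀ y : F, ∑ x : F, ψ (b * x) * ψ (w⁻¹ * y ^ 3 - 3 * (y * x)) =
        if y = b / 3 then Fintype.card F * ψ (b ^ 3 * (3 ^ 3 * w)⁻¹) else 0 := by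
      intro y
      have h2 : ∀ x : F, ψ (b * x) * ψ (w⁻¹ * y ^ 3 - 3 * (y * x)) =
          ψ (w⁻¹ * y ^ 3) * ψ (x * (b - 3 * y)) := by
        intro x
        rw [← AddChar.map_add_eq_mul, ← AddChar.map_add_eq_mul]
        congr 1
        ring
      rw [Finset.sum_congr rfl fun x _ => h2 x, ← Finset.mul_sum, AddChar.sum_mulShift _ hψ]
      have h4 : b - 3 * y = 0 ↔ y = b / 3 := by
        rw [eq_div_iff h3]
        constructor <;> intro h <;> linear_combination -h
      simp only [h4]
      split_ifs with h
      · rw [h, mul_comm]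
        congr 2
        field_simp
      · simp
    simp only [Finset.mul_sum]
    rw [Finset.sum_comm, Finset.sum_congr rfl fun y _ => h1 y]
    simp
  have hswap : ∑ A : F, χ A * (ψ ((w * A)⁻¹) * ∑ x : F, ψ (A * w ^ 2 * x ^ 3 + b * x)) =
      ∑ x : F, ψ (b * x) * ∑ A : F, χ A * ψ ((w * A)⁻¹ + A * w ^ 2 * x ^ 3) := by
    simp only [Finset.mul_sum]
    rw [Finset.sum_comm]
    refine Finset.sum_congr rfl fun x _ => Finset.sum_congr rfl fun A _ => ?_
    rw [AddChar.map_add_eq_mul, AddChar.map_add_eq_mul]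
    ring
  have hrest : ∀ x ∈ Finset.univ.erase (0 : F),
      ψ (b * x) * ∑ A : F, χ A * ψ ((w * A)⁻¹ + A * w ^ 2 * x ^ 3) =
        ψ (b * x) * ∑ y : F, ψ (w⁻¹ * y ^ 3 - 3 * (y * x)) := by
    intro x hx
    rw [hinner x (Finset.ne_of_mem_erase hx)]
  rw [hswap, ← hfourier, ← Finset.add_sum_erase _ _ (Finset.mem_univ (0 : F)), hzero,
    ← Finset.add_sum_erase _ (fun x => ψ (b * x) * ∑ y : F, ψ (w⁻¹ * y ^ 3 - 3 * (y * x)))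
      (Finset.mem_univ (0 : F)), hcube, Finset.sum_congr rfl hrest, mul_zero,
    AddChar.map_zero_eq_one]
  ring

end Field
end

noncomputable section

/-! ### Truncated discrete valuation rings and stationary phase -/

section Truncated

open Classical

theorem sum_comp_addMonoidHom {G H : Type*} [AddCommGroup G] [Fintype G] [AddCommGroup H]
    [Fintype H] (f : G →+ H) (φ : H → ℂ) :
    ∑ g, φ (f g) = (Finset.univ.filter fun g => f g = 0).card *
      ∑ h with ∃ g, f g = h, φ h := by
  rw [← Finset.sum_fiberwise Finset.univ f, Finset.mul_sum, Finset.sum_filter]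
  refine Finset.sum_congr rfl fun h _ => ?_
  rw [Finset.sum_congr rfl fun g hg => by rw [(Finset.mem_filter_univ _).mp hg]]
  rw [Finset.sum_const, nsmul_eq_mul]
  split_ifs with hh
  · obtain ⟨g₀, rfl⟩ := hh
    congr 2
    refine Finset.card_nbij' (fun g => g - g₀) (fun g => g + g₀) ?_ ?_ ?_ ?_ <;> intro g <;>
      simp +contextual
  · rw [Finset.card_eq_zero.mpr, Nat.cast_zero, zero_mul]
    ext g
    simpa using fun hg => hh ⟨g, hg⟩

variable {R F : Type*} [CommRing R] [Fintype R] [Field F] [Fintype F]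

/-- Averaging over all the permutations σ y z leaves the sum unchanged, while orthogonality of ψ
removes every x at which the linear response (h₁, h₂) is nonzero. This is the only source of
cancellation in the stationary phase arguments. -/
theorem sum_eq_sum_filter_of_shift {ψ : AddChar R ℂ} (hψ : ψ.IsPrimitive) {X : Type*} [Fintype X]
    (f : X → ℂ) (σ : R → R → Equiv.Perm X) (h₁ h₂ : X → R)
    (H : ∀ y z x, f (σ y z x) = f x * ψ (h₁ x * y + h₂ x * z)) :
    ∑ x, f x = ∑ x with h₁ x = 0 ∧ h₂ x = 0, f x := by
  have hR : (Fintype.card R : ℂ) ≠ 0 := by simp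
  refine mul_left_cancel₀ (mul_ne_zero hR hR) ?_
  have h1 : (Fintype.card R * Fintype.card R : ℂ) * ∑ x, f x =
      ∑ y : R, ∑ z : R, ∑ x, f (σ y z x) := by
    simp only [Equiv.sum_comp, Finset.sum_const, Finset.card_univ, nsmul_eq_mul, mul_assoc]
  have h2 : ∀ x, ∑ y : R, ∑ z : R, f (σ y z x) =
      if h₁ x = 0 ∧ h₂ x = 0 then (Fintype.card R * Fintype.card R : ℂ) * f x else 0 := by
    intro x
    have h3 : ∀ y z, f (σ y z x) = f x * (ψ (y * h₁ x) * ψ (z * h₂ x)) := by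
      intro y z
      rw [H, AddChar.map_add_eq_mul, mul_comm y, mul_comm z]
    simp only [h3, ← Finset.mul_sum, ← Finset.sum_mul, AddChar.sum_mulShift _ hψ]
    by_cases ha : h₁ x = 0 <;> by_cases hb : h₂ x = 0 <;> simp [ha, hb]
    ring
  rw [h1, Finset.mul_sum, Finset.sum_filter, ← Finset.sum_congr rfl fun x _ => h2 x,
    Finset.sum_comm (s := (Finset.univ : Finset X))]
  exact Finset.sum_congr rfl fun y _ => Finset.sum_comm

/-- The quotient of a discrete valuation ring by the `k`-th power of its maximal ideal: `r` is the
reduction to the residue field and `π` the image of a uniformizer. -/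
structure IsTruncatedDVR (r : R →+* F) (π : R) (k : ℕ) : Prop where
  surjective : Function.Surjective r
  map_eq_zero_iff : ∀ x, r x = 0 ↔ π ∣ x
  pow_mul_eq_zero_iff : ∀ m ≤ k, ∀ y, π ^ m * y = 0 ↔ π ^ (k - m) ∣ y
  card_annihilator : ∀ m ≤ k, (Finset.univ.filter fun y : R => π ^ m * y = 0).card =
    Fintype.card F ^ m

namespace IsTruncatedDVR

variable {r : R →+* F} {π : R} {k : ℕ} (h : IsTruncatedDVR r π k)
include h

theorem pow_eq_zero {m : ℕ} (hm : k ≤ m) : π ^ m = 0 := by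
  have := (h.pow_mul_eq_zero_iff k le_rfl 1).mpr (by simp)
  rw [mul_one] at this
  rw [← Nat.sub_add_cancel hm, pow_add, this, mul_zero]

theorem card_eq : Fintype.card R = Fintype.card F ^ k := by
  rw [← h.card_annihilator k le_rfl]
  simp [h.pow_eq_zero le_rfl]

theorem isUnit_iff (x : R) : IsUnit x ↔ r x ≠ 0 := by
  constructor
  · exact fun hx => (hx.map r).ne_zero
  · intro hx
    obtain ⟨y, hy⟩ := h.surjective (r x)⁻¹
    have h1 : r (x * y - 1) = 0 := by
      rw [map_sub, map_mul, hy, mul_inv_cancel₀ hx, map_one, sub_self]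
    obtain ⟨z, hz⟩ := (h.map_eq_zero_iff _).mp h1
    have hn : IsNilpotent (π * z) := ⟨k, by rw [mul_pow, h.pow_eq_zero le_rfl, zero_mul]⟩
    have h2 : IsUnit (x * y) := by
      rw [sub_eq_iff_eq_add'.mp hz]
      exact hn.isUnit_one_add
    exact isUnit_of_mul_isUnit_left h2

theorem map_uniformizer : r π = 0 := (h.map_eq_zero_iff π).mpr dvd_rfl

theorem map_one_add {m : ℕ} (hm : 1 ≤ m) (y : R) : r (1 + π ^ m * y) = 1 := by
  rw [map_add, map_mul, map_pow, h.map_uniformizer, zero_pow (by omega), zero_mul, map_one,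
    add_zero]

theorem isUnit_one_add {m : ℕ} (hm : 1 ≤ m) (y : R) : IsUnit (1 + π ^ m * y) := by
  rw [h.isUnit_iff, h.map_one_add hm]
  exact one_ne_zero

theorem sum_pow_mul {m : ℕ} (hm : m ≤ k) (φ : R → ℂ) :
    ∑ y, φ (π ^ m * y) = Fintype.card F ^ m * ∑ x with π ^ m ∣ x, φ x := by
  refine (sum_comp_addMonoidHom (AddMonoidHom.mulLeft (π ^ m)) φ).trans ?_
  rw [← Nat.cast_pow, ← h.card_annihilator m hm]
  simp only [AddMonoidHom.coe_mulLeft, Dvd.dvd, eq_comm]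
  congr!

theorem sum_comp_reduction (hk : 1 ≤ k) (φ : F → ℂ) :
    ∑ x, φ (r x) = Fintype.card F ^ (k - 1) * ∑ a, φ a := by
  have := sum_comp_addMonoidHom r.toAddMonoidHom φ
  simp only [RingHom.toAddMonoidHom_eq_coe, AddMonoidHom.coe_coe] at this
  rw [this]
  congr 1
  · rw [← Nat.cast_pow, ← h.card_annihilator (k - 1) (by omega)]
    congr 2
    ext x
    rw [Finset.mem_filter_univ, Finset.mem_filter_univ, h.pow_mul_eq_zero_iff _ (by omega),
      h.map_eq_zero_iff, Nat.sub_sub_self hk, pow_one]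
  · rw [Finset.filter_true_of_mem fun a _ => h.surjective a]

/-- Summing over a short progression restricts `x` to multiples of the uniformizer. -/
theorem card_mul_sum_cubic (hk : 2 ≤ k) {ψ : AddChar R ℂ} (hψ : ψ.IsPrimitive) (h3 : (3 : F) ≠ 0)
    {a b : R} (ha : r a ≠ 0) (hb : π ∣ b) :
    Fintype.card F * ∑ x, ψ (a * x ^ 3 + b * x) =
      ∑ x, ψ (π ^ 3 * (a * x ^ 3) + π * b * x) := by
  obtain ⟨c, rfl⟩ := hb
  have h0 : π ^ (k - 1) * π = 0 := by
    rw [← pow_succ, h.pow_eq_zero (by omega)]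
  have h2 : π ^ (k - 1) * π ^ (k - 1) = 0 := by
    rw [← pow_add, h.pow_eq_zero (by omega)]
  -- Terms of degree at least 2 in the shift vanish since 2(k - 1) ≥ k, and the shift of bx vanishes
  -- since π ∣ b; what is left detects 3ax² modulo π.
  rw [sum_eq_sum_filter_of_shift hψ _ (fun y _ => Equiv.addRight (π ^ (k - 1) * y))
    (fun x => π ^ (k - 1) * (3 * a * x ^ 2)) (fun _ => 0)]
  · have h4 := h.sum_pow_mul (m := 1) (by omega) fun x => ψ (a * x ^ 3 + π * c * x)
    simp only [pow_one] at h4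
    have h5 : (Finset.univ.filter fun x : R => π ^ (k - 1) * (3 * a * x ^ 2) = 0 ∧ (0 : R) = 0) =
        Finset.univ.filter fun x => π ∣ x := by
      ext x
      simp only [Finset.mem_filter_univ, and_true]
      rw [h.pow_mul_eq_zero_iff _ (by omega), Nat.sub_sub_self (by omega), pow_one,
        ← h.map_eq_zero_iff, ← h.map_eq_zero_iff]
      have hr3 : r 3 ≠ 0 := by rwa [map_ofNat]
      rw [map_mul, map_mul, map_pow]
      simp [hr3, ha]
    rw [h5, ← h4]
    refine Finset.sum_congr rfl fun x _ => ?_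
    congr 1
    ring
  · intro y z x
    rw [← AddChar.map_add_eq_mul, Equiv.coe_addRight]
    congr 1
    linear_combination (c * y) * h0 + (3 * a * x * y ^ 2 + a * y ^ 3 * π ^ (k - 1)) * h2


theorem sum_reparam {i : ℕ} (hi : i ≤ k) (f : R × R → ℂ) :
    Fintype.card F ^ (2 * i) * ∑ x with π ^ i ∣ x.1 - 1 ∧ π ^ i ∣ x.2 - 1, f x =
      ∑ y, ∑ z, f (1 + π ^ i * y, 1 + π ^ i * z) := by
  have h1 : ∑ x with π ^ i ∣ x.1 - 1 ∧ π ^ i ∣ x.2 - 1, f x =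
      ∑ a with π ^ i ∣ a, ∑ b with π ^ i ∣ b, f (1 + a, 1 + b) := by
    simp only [Finset.sum_filter]
    rw [Fintype.sum_prod_type, ← Equiv.sum_comp (Equiv.addLeft (1 : R))]
    refine Finset.sum_congr rfl fun a _ => ?_
    rw [← Equiv.sum_comp (Equiv.addLeft (1 : R))]
    by_cases ha : π ^ i ∣ a <;> simp [ha]
  rw [h1, h.sum_pow_mul hi fun a => ∑ z, f (1 + a, 1 + π ^ i * z), two_mul, pow_add, mul_assoc]
  congr 1
  rw [Finset.mul_sum]
  exact Finset.sum_congr rfl fun a _ => (h.sum_pow_mul hi fun b => f (1 + a, 1 + b)).symm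

/-- The discriminant -3 is the square of the unit 1 + 2ω. Translating y by -(1 - ω)z removes z²,
leaving y(y + (1 + 2ω)z), which is linear in z; the z-sum then detects π^m y = 0. -/
theorem sum_split_quadratic {ψ : AddChar R ℂ} (hψ : ψ.IsPrimitive) (h3 : (3 : F) ≠ 0) {ω v : R}
    (hω : ω ^ 2 + ω + 1 = 0) (hv : IsUnit v) {m : ℕ} (hm : m ≤ k) :
    ∑ y, ∑ z, ψ (-(π ^ m * v * (y ^ 2 + 3 * y * z + 3 * z ^ 2))) =
      (Fintype.card F : ℂ) ^ (k + m) := by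
  have hd : IsUnit (1 + 2 * ω) := by
    rw [h.isUnit_iff]
    intro h0
    have h1 : r ((1 + 2 * ω) ^ 2) = r (-3) := by
      congr 1
      linear_combination 4 * hω
    rw [map_pow, h0, map_neg, map_ofNat] at h1
    apply h3
    linear_combination h1
  have h1 : ∀ z, ∑ y, ψ (-(π ^ m * v * (y ^ 2 + 3 * y * z + 3 * z ^ 2))) =
      ∑ y, ψ (-(π ^ m * v * (y ^ 2 + (1 + 2 * ω) * y * z))) := by
    intro z
    rw [← Equiv.sum_comp (Equiv.addRight (-((1 - ω) * z)))]
    refine Finset.sum_congr rfl fun y _ => ?_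
    rw [Equiv.coe_addRight]
    congr 1
    linear_combination (-(π ^ m * v * z ^ 2)) * hω
  have h2 : ∀ y, ∑ z, ψ (-(π ^ m * v * (y ^ 2 + (1 + 2 * ω) * y * z))) =
      if π ^ m * y = 0 then (Fintype.card R : ℂ) else 0 := by
    intro y
    have h4 : ∀ z, ψ (-(π ^ m * v * (y ^ 2 + (1 + 2 * ω) * y * z))) =
        ψ (-(π ^ m * y * (v * y))) * ψ (z * (π ^ m * y * -(v * (1 + 2 * ω)))) := by
      intro z
      rw [← AddChar.map_add_eq_mul]
      congr 1
      ring
    rw [Finset.sum_congr rfl fun z _ => h4 z, ← Finset.mul_sum, AddChar.sum_mulShift _ hψ,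
      (hv.mul hd).neg.mul_left_eq_zero]
    split_ifs with h5
    · rw [h5]; simp
    · simp
  rw [Finset.sum_comm, Finset.sum_congr rfl fun z _ => h1 z, Finset.sum_comm,
    Finset.sum_congr rfl fun y _ => h2 y, ← Finset.sum_filter, Finset.sum_const,
    h.card_annihilator m hm, nsmul_eq_mul, h.card_eq, pow_add]
  push_cast
  ring

/-- The geometric series, cut off where π^e annihilates the remainder. -/
theorem inverse_mul_one_add {m e : ℕ} (hm : 1 ≤ m) (hme : k ≤ e + 2 * m) (y : R) :
    π ^ e * Ring.inverse (1 + π ^ m * y) = π ^ e * (1 - π ^ m * y) := by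
  have hu := Ring.mul_inverse_cancel _ (h.isUnit_one_add hm y)
  have h0 : π ^ e * (π ^ m) ^ 2 = 0 := by
    rw [← pow_mul, ← pow_add, h.pow_eq_zero (by omega)]
  set u := Ring.inverse (1 + π ^ m * y)
  linear_combination (π ^ e * (1 - π ^ m * y)) * hu + u * y ^ 2 * h0

theorem inverse_mul_one_add' {m e : ℕ} (hm : 1 ≤ m) (hme : k ≤ e + 3 * m) (y : R) :
    π ^ e * Ring.inverse (1 + π ^ m * y) = π ^ e * (1 - π ^ m * y + (π ^ m * y) ^ 2) := by
  have hu := Ring.mul_inverse_cancel _ (h.isUnit_one_add hm y)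
  have h0 : π ^ e * (π ^ m) ^ 3 = 0 := by
    rw [← pow_mul, ← pow_add, h.pow_eq_zero (by omega)]
  set u := Ring.inverse (1 + π ^ m * y)
  linear_combination (π ^ e * (1 - π ^ m * y + (π ^ m * y) ^ 2)) * hu - u * y ^ 3 * h0

/-- Modulo π^i the conditions read α²ξ³ = 1 and αξ² = 1; squaring the second and comparing gives ξ =
1, then α = 1. -/
theorem critical_iff {i : ℕ} (hi : i ≤ k) (h3 : (3 : F) ≠ 0) {α ξ v : R} (hα : IsUnit α)
    (hv : IsUnit v) :
    (π ^ (k - i) * v * (Ring.inverse α - α * ξ ^ 3) = 0 ∧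
      π ^ (k - i) * v * (3 - 3 * α * ξ ^ 2) = 0) ↔ π ^ i ∣ α - 1 ∧ π ^ i ∣ ξ - 1 := by
  have hu3 : IsUnit (3 : R) := by rwa [h.isUnit_iff, map_ofNat]
  have hu := Ring.mul_inverse_cancel _ hα
  set u := Ring.inverse α
  rw [mul_right_comm, hv.mul_left_eq_zero, mul_right_comm, hv.mul_left_eq_zero,
    show (3 : R) - 3 * α * ξ ^ 2 = (1 - α * ξ ^ 2) * 3 by ring, ← mul_assoc,
    hu3.mul_left_eq_zero, h.pow_mul_eq_zero_iff _ (Nat.sub_le _ _),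
    h.pow_mul_eq_zero_iff _ (Nat.sub_le _ _), Nat.sub_sub_self hi]
  constructor
  · rintro ⟨⟨a, ha⟩, ⟨b, hb⟩⟩
    have h1 : ξ - 1 = π ^ i * (α * ξ * a - (1 + α * ξ ^ 2) * b) := by
      linear_combination α * ξ * ha - (1 + α * ξ ^ 2) * hb - ξ * hu
    refine ⟨⟨-b - α * (ξ + 1) * (α * ξ * a - (1 + α * ξ ^ 2) * b), ?_⟩, ⟨_, h1⟩⟩
    linear_combination -hb - α * (ξ + 1) * h1
  · rintro ⟨⟨a, ha⟩, ⟨b, hb⟩⟩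
    refine ⟨⟨-u * ((α + 1) * ξ ^ 3 * a + (ξ ^ 2 + ξ + 1) * b), ?_⟩,
      ⟨-(ξ ^ 2 * a) - (ξ + 1) * b, ?_⟩⟩
    · linear_combination (-u * (α + 1) * ξ ^ 3) * ha - u * (ξ ^ 2 + ξ + 1) * hb +
        (α * ξ ^ 3) * hu
    · linear_combination (-ξ ^ 2) * ha - (ξ + 1) * hb

/-- The stationary phase evaluation of the normalized sum. -/
theorem sum_stationary_phase {ψ : AddChar R ℂ} (hψ : ψ.IsPrimitive) (χ : MulChar F ℂ)
    (h3 : (3 : F) ≠ 0) {ω v : R} (hω : ω ^ 2 + ω + 1 = 0) (hv : IsUnit v) (hk : 5 ≤ k) :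
    ∑ α, ∑ ξ, χ (r α) ^ k * ψ (π ^ 3 * v * (3 * ξ - α * ξ ^ 3 - Ring.inverse α)) =
      (Fintype.card F : ℂ) ^ (k + 3) * ψ (π ^ 3 * v) := by
  -- The shift has size π^s and the critical point is located modulo π^i. Since 3 + 2s ≥ k the shift
  -- acts linearly, and since 3 + 3i ≥ k the phase near the critical point is quadratic; k ≥ 5
  -- ensures i ≥ 1.
  obtain ⟨i, s, hi, his, hsi, hks⟩ : ∃ i s : ℕ, 1 ≤ i ∧ i ≤ s ∧ s ≤ i + 1 ∧ k = 3 + i + s :=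
    ⟨(k - 3) / 2, k - 3 - (k - 3) / 2, by omega, by omega, by omega, by omega⟩
  have hq : (Fintype.card F : ℂ) ≠ 0 := by simp
  rw [← Fintype.sum_prod_type' (f := fun α ξ => χ (r α) ^ k *
    ψ (π ^ 3 * v * (3 * ξ - α * ξ ^ 3 - Ring.inverse α)))]
  set f : R × R → ℂ := fun x => χ (r x.1) ^ k *
    ψ (π ^ 3 * v * (3 * x.2 - x.1 * x.2 ^ 3 - Ring.inverse x.1)) with hf
  have hnon : ∀ x : R × R, ¬ IsUnit x.1 → f x = 0 := by
    intro x hx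
    rw [h.isUnit_iff, not_not] at hx
    simp only [hf]
    rw [hx, MulChar.map_zero, zero_pow (by omega), zero_mul]
  have hshift := sum_eq_sum_filter_of_shift hψ f
    -- The shift of α is multiplicative by 1 + π^s y, which reduces to 1 and so does not affect χ.
    (fun y z => (((h.isUnit_one_add (hi.trans his) y).unit.mulRight).prodCongr
      (Equiv.addRight (π ^ s * z))))
    (fun x => π ^ (k - i) * v * (Ring.inverse x.1 - x.1 * x.2 ^ 3))
    (fun x => π ^ (k - i) * v * (3 - 3 * x.1 * x.2 ^ 2)) ?_
  · rw [hshift]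
    have hfilter : (∑ x with π ^ (k - i) * v * (Ring.inverse x.1 - x.1 * x.2 ^ 3) = 0 ∧
        π ^ (k - i) * v * (3 - 3 * x.1 * x.2 ^ 2) = 0, f x) =
        ∑ x with π ^ i ∣ x.1 - 1 ∧ π ^ i ∣ x.2 - 1, f x := by
      simp only [Finset.sum_filter]
      refine Finset.sum_congr rfl fun x _ => ?_
      by_cases hx : IsUnit x.1
      · simp only [h.critical_iff (i := i) (by omega) h3 hx hv]
      · simp only [hnon x hx, ite_self]
    rw [hfilter]
    refine mul_left_cancel₀ (pow_ne_zero (2 * i) hq) ?_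
    rw [h.sum_reparam (by omega)]
    -- Taylor expansion at (1, 1): the value is 3 - 1 - 1 = 1, and the linear terms cancel.
    have hloc : ∀ y z, f (1 + π ^ i * y, 1 + π ^ i * z) =
        ψ (π ^ 3 * v) * ψ (-(π ^ (3 + 2 * i) * v * (y ^ 2 + 3 * y * z + 3 * z ^ 2))) := by
      intro y z
      have h0 : π ^ 3 * (π ^ i) ^ 3 = 0 := by
        rw [← pow_mul, ← pow_add, h.pow_eq_zero (by omega)]
      have hinv := h.inverse_mul_one_add' (e := 3) hi (by omega) y
      simp only [hf]
      rw [h.map_one_add hi, map_one, one_pow, one_mul, ← AddChar.map_add_eq_mul]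
      congr 1
      have hp : π ^ (3 + 2 * i) = π ^ 3 * (π ^ i) ^ 2 := by ring
      rw [hp]
      linear_combination (-v) * hinv - v * (z ^ 3 + 3 * y * z ^ 2 + y * z ^ 3 * π ^ i) * h0
    simp only [hloc, ← Finset.mul_sum]
    rw [h.sum_split_quadratic hψ h3 hω hv (by omega)]
    ring
  · rintro y z ⟨α, ξ⟩
    by_cases hα : IsUnit α
    · have h0 : π ^ 3 * (π ^ s) ^ 2 = 0 := by
        rw [← pow_mul, ← pow_add, h.pow_eq_zero (by omega)]
      have hinv := h.inverse_mul_one_add (e := 3) (hi.trans his) (by omega) y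
      have hki : π ^ (k - i) = π ^ 3 * π ^ s := by
        rw [← pow_add]; congr 1; omega
      simp only [hf, Equiv.prodCongr_apply, Prod.map_apply, Units.mulRight_apply,
        IsUnit.unit_spec, Equiv.coe_addRight]
      rw [mul_assoc (χ _ ^ k), ← AddChar.map_add_eq_mul, Ring.mul_inverse_rev, hki, map_mul r,
        h.map_one_add (hi.trans his), mul_one]
      congr 2
      linear_combination (-v * Ring.inverse α) * hinv +
        (-v * α) * (3 * ξ ^ 2 * y * z + 3 * ξ * z ^ 2 + 3 * ξ * y * z ^ 2 * π ^ s +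
          z ^ 3 * π ^ s + y * z ^ 3 * (π ^ s) ^ 2) * h0
    · rw [hnon (α, ξ) hα, zero_mul]
      exact hnon _ (by simpa [h.isUnit_one_add (hi.trans his) y] using hα)

end IsTruncatedDVR

end Truncated
end

noncomputable section

/-! ### The cubic sum over a truncated discrete valuation ring, case by case -/

section Truncated

variable {R F : Type*} [CommRing R] [Fintype R] [Field F] [Fintype F]

/-- The twisted cubic sum over a quotient of a discrete valuation ring. -/
def truncatedCubicSum (r : R →+* F) (ψ : AddChar R ℂ) (χ : MulChar F ℂ) (π w B : R) (j k : ℕ) :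
    ℂ :=
  ∑ A, χ (r A) ^ k * (ψ (π ^ 3 * Ring.inverse (w * A)) *
    ∑ x, ψ (A * w ^ 2 * x ^ 3 + π ^ j * B * x))

namespace IsTruncatedDVR

variable {r : R →+* F} {π : R} {k : ℕ} (h : IsTruncatedDVR r π k) {ψ : AddChar R ℂ}
  (hψ : ψ.IsPrimitive) (χ : MulChar F ℂ) (h3 : (3 : F) ≠ 0) {w B : R} {j : ℕ}
include h hψ h3

/-- Only multiples of π contribute to the x-sum; parametrizing them as πx covers each one q times,
whence the factor q. -/
theorem card_mul_truncatedCubicSum (hw : r w ≠ 0) (hj : 1 ≤ j) (hk : 2 ≤ k) :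
    Fintype.card F * truncatedCubicSum r ψ χ π w B j k =
      ∑ A, ∑ x, χ (r A) ^ k *
        ψ (π ^ 3 * (Ring.inverse (w * A) + A * w ^ 2 * x ^ 3) + π ^ (j + 1) * B * x) := by
  rw [truncatedCubicSum, Finset.mul_sum]
  refine Finset.sum_congr rfl fun A _ => ?_
  by_cases hA : r A = 0
  · simp [hA, MulChar.map_zero, zero_pow (show k ≠ 0 by omega)]
  · rw [mul_left_comm, mul_left_comm (Fintype.card F : ℂ), h.card_mul_sum_cubic hk hψ h3
      (by simp [hw, hA]) ((dvd_pow_self π (by omega)).mul_right B), Finset.mul_sum, Finset.mul_sum]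
    refine Finset.sum_congr rfl fun x _ => ?_
    rw [← AddChar.map_add_eq_mul]
    congr 2
    ring

theorem truncatedCubicSum_two (hχ : χ ^ 3 = 1) (hχ1 : χ ≠ 1) (hw : r w ≠ 0) (hj : 1 ≤ j)
    (hk : k = 2) : truncatedCubicSum r ψ χ π w B j k = 0 := by
  have hq : (Fintype.card F : ℂ) ≠ 0 := by simp
  refine (mul_eq_zero.mp ?_).resolve_left hq
  rw [h.card_mul_truncatedCubicSum hψ χ h3 hw hj hk.ge, h.pow_eq_zero (m := 3) (by omega),
    h.pow_eq_zero (m := j + 1) (by omega), hk]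
  simp only [zero_mul, add_zero, AddChar.map_zero_eq_one, mul_one, Finset.sum_const, nsmul_eq_mul,
    ← Finset.mul_sum]
  rw [h.sum_comp_reduction (by omega) fun a => χ a ^ 2, MulChar.sum_sq_eq_zero hχ hχ1]
  simp

/-- Translating x by π^(k-3) y fixes the part of the phase multiplied by π³ and changes the linear
term by π^(k-1)By, which is nontrivial in y for every x. -/
theorem truncatedCubicSum_of_eq_one (hw : r w ≠ 0) (hB : r B ≠ 0) (hj : j = 1) (hk : 3 ≤ k) :
    truncatedCubicSum r ψ χ π w B j k = 0 := by
  classical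
  have hq : (Fintype.card F : ℂ) ≠ 0 := by simp
  refine (mul_eq_zero.mp ?_).resolve_left hq
  rw [h.card_mul_truncatedCubicSum hψ χ h3 hw hj.ge (by omega), hj]
  refine Finset.sum_eq_zero fun A _ => ?_
  rw [sum_eq_sum_filter_of_shift hψ _ (fun y _ => Equiv.addRight (π ^ (k - 3) * y))
    (fun _ => π ^ (k - 1) * B) (fun _ => 0)]
  · rw [Finset.filter_false_of_mem, Finset.sum_empty]
    intro x _
    rw [h.pow_mul_eq_zero_iff _ (by omega), Nat.sub_sub_self (by omega), pow_one,
      ← h.map_eq_zero_iff]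
    simp [hB]
  · intro y z x
    have h0 : π ^ 3 * π ^ (k - 3) = 0 := by rw [← pow_add, h.pow_eq_zero (by omega)]
    have h1 : π ^ (k - 1) = π ^ 2 * π ^ (k - 3) := by rw [← pow_add]; congr 1; omega
    rw [mul_assoc (χ (r A) ^ k), ← AddChar.map_add_eq_mul, Equiv.coe_addRight, h1]
    congr 2
    linear_combination (A * w ^ 2 * (3 * x ^ 2 * y + 3 * x * y ^ 2 * π ^ (k - 3) +
      y ^ 3 * (π ^ (k - 3)) ^ 2)) * h0

theorem truncatedCubicSum_three (hχ : χ ^ 3 = 1) (hw : r w ≠ 0) (hj : 2 ≤ j)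
    (hk : k = 3) : truncatedCubicSum r ψ χ π w B j k =
      Nat.card Rˣ * (Fintype.card F : ℂ) ^ 2 := by
  classical
  have hq : (Fintype.card F : ℂ) ≠ 0 := by simp
  refine mul_left_cancel₀ hq ?_
  have hunits : ∑ A : R, χ (r A) ^ 3 = Nat.card Rˣ := by
    have h1 : ∀ A : R, χ (r A) ^ 3 = (1 : MulChar R ℂ) A := by
      intro A
      by_cases hA : r A = 0
      · rw [MulChar.map_nonunit (1 : MulChar R ℂ) (by rw [h.isUnit_iff, not_not]; exact hA), hA,
          MulChar.map_zero]
        norm_num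
      · rw [MulChar.one_apply ((h.isUnit_iff A).mpr hA), MulChar.apply_pow_three hχ hA]
    rw [Finset.sum_congr rfl fun A _ => h1 A, MulChar.sum_one_eq_card_units,
      Nat.card_eq_fintype_card]
  rw [h.card_mul_truncatedCubicSum hψ χ h3 hw (by omega) (by omega),
    h.pow_eq_zero (m := 3) (by omega), h.pow_eq_zero (m := j + 1) (by omega)]
  simp only [zero_mul, add_zero, AddChar.map_zero_eq_one, mul_one, Finset.sum_const, nsmul_eq_mul,
    ← Finset.mul_sum, Finset.card_univ]
  rw [hk, hunits, h.card_eq, hk]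
  push_cast
  ring

/-- Here χ⁴ = χ and the phase is a multiple of π³, so the summand depends only on A and x modulo π.
Each of the two reductions contributes q³, and one factor q is divided out. -/
theorem truncatedCubicSum_four [DecidableEq F] (hχ : χ ^ 3 = 1) (hχ1 : χ ≠ 1) {ω : F}
    (hω : ω ^ 2 + ω + 1 = 0) (hw : r w ≠ 0) (hj : 2 ≤ j) (hk : k = 4) {ψ' : AddChar F ℂ}
    (hψ' : ψ'.IsPrimitive) (hr : ∀ x, ψ (π ^ 3 * x) = ψ' (r x)) :
    truncatedCubicSum r ψ χ π w B j k =
      (Fintype.card F : ℂ) ^ 5 * (Fintype.card F *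
        ψ' (r (π ^ (j - 2) * B) ^ 3 * (3 ^ 3 * r w)⁻¹) - χ (r w) * gaussSum χ ψ') := by
  have hq : (Fintype.card F : ℂ) ≠ 0 := by simp
  refine mul_left_cancel₀ hq ?_
  rw [h.card_mul_truncatedCubicSum hψ χ h3 hw (by omega) (by omega),
    ← sum_kloosterman_cubic hχ hχ1 hω h3 hψ' hw]
  have h1 : ∀ A x, χ (r A) ^ k *
      ψ (π ^ 3 * (Ring.inverse (w * A) + A * w ^ 2 * x ^ 3) + π ^ (j + 1) * B * x) =
      χ (r A) * ψ' ((r w * r A)⁻¹ + (r A * r w ^ 2 * r x ^ 3 + r (π ^ (j - 2) * B) * r x)) := by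
    intro A x
    by_cases hA : r A = 0
    · simp [hA, MulChar.map_zero, zero_pow (show k ≠ 0 by omega)]
    · have hu : IsUnit (w * A) := (h.isUnit_iff _).mpr (by simp [hw, hA])
      have hinv : r (Ring.inverse (w * A)) = (r w * r A)⁻¹ := by
        rw [← map_mul]
        apply eq_inv_of_mul_eq_one_left
        rw [← map_mul, Ring.inverse_mul_cancel _ hu, map_one]
      have hπ : π ^ (j + 1) = π ^ 3 * π ^ (j - 2) := by rw [← pow_add]; congr 1; omega
      rw [hk, pow_succ, MulChar.apply_pow_three hχ hA, one_mul, hπ,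
        show π ^ 3 * (Ring.inverse (w * A) + A * w ^ 2 * x ^ 3) + π ^ 3 * π ^ (j - 2) * B * x =
          π ^ 3 * (Ring.inverse (w * A) + (A * w ^ 2 * x ^ 3 + π ^ (j - 2) * B * x)) by ring, hr]
      simp only [map_add, map_mul, map_pow, hinv]
  simp only [h1]
  have h2 : ∀ a : F, ∑ x : R, χ a *
      ψ' ((r w * a)⁻¹ + (a * r w ^ 2 * r x ^ 3 + r (π ^ (j - 2) * B) * r x)) =
      (Fintype.card F : ℂ) ^ 3 * (χ a * (ψ' ((r w * a)⁻¹) *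
        ∑ x : F, ψ' (a * r w ^ 2 * x ^ 3 + r (π ^ (j - 2) * B) * x))) := by
    intro a
    rw [h.sum_comp_reduction (by omega) fun x => χ a *
      ψ' ((r w * a)⁻¹ + (a * r w ^ 2 * x ^ 3 + r (π ^ (j - 2) * B) * x)), hk]
    simp only [AddChar.map_add_eq_mul ψ' ((r w * a)⁻¹), Finset.mul_sum]
  simp only [h2]
  rw [h.sum_comp_reduction (by omega) fun a => (Fintype.card F : ℂ) ^ 3 *
    (χ a * (ψ' ((r w * a)⁻¹) *
        ∑ x : F, ψ' (a * r w ^ 2 * x ^ 3 + r (π ^ (j - 2) * B) * x))), ← Finset.mul_sum, hk]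
  ring

/-- For shifts of size π^(k-4) the linear term π^(j+1)Bx is invariant because j ≥ 3. Criticality in
x forces x ≡ 0 modulo π, and criticality in A then forces (wA)⁻¹ ≡ 0, which is impossible. -/
theorem truncatedCubicSum_eq_zero (hw : r w ≠ 0) (hj : 3 ≤ j) (hk : 5 ≤ k) :
    truncatedCubicSum r ψ χ π w B j k = 0 := by
  classical
  have hq : (Fintype.card F : ℂ) ≠ 0 := by simp
  refine (mul_eq_zero.mp ?_).resolve_left hq
  rw [h.card_mul_truncatedCubicSum hψ χ h3 hw (by omega) (by omega),
    ← Fintype.sum_prod_type' (f := fun A x => χ (r A) ^ k *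
      ψ (π ^ 3 * (Ring.inverse (w * A) + A * w ^ 2 * x ^ 3) + π ^ (j + 1) * B * x))]
  rw [sum_eq_sum_filter_of_shift hψ _
    (fun y z => (((h.isUnit_one_add (m := k - 4) (by omega) y).unit.mulRight).prodCongr
      (Equiv.addRight (π ^ (k - 4) * z))))
    (fun x => π ^ (k - 1) * (x.1 * w ^ 2 * x.2 ^ 3 - Ring.inverse (w * x.1)))
    (fun x => π ^ (k - 1) * (3 * x.1 * w ^ 2 * x.2 ^ 2))]
  · refine Finset.sum_eq_zero fun x hx => ?_
    rw [Finset.mem_filter_univ] at hx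
    by_cases hA : r x.1 = 0
    · simp [hA, MulChar.map_zero, zero_pow (show k ≠ 0 by omega)]
    · exfalso
      have hu : IsUnit (w * x.1) := (h.isUnit_iff _).mpr (by simp [hw, hA])
      simp only [h.pow_mul_eq_zero_iff _ (Nat.sub_le k 1), Nat.sub_sub_self (show 1 ≤ k by omega),
        pow_one, ← h.map_eq_zero_iff, map_mul, map_sub, map_pow, map_ofNat] at hx
      obtain ⟨hx1, hx2⟩ := hx
      have hx0 : r x.2 = 0 := by simpa [h3, hA, hw] using hx2
      rw [hx0] at hx1
      have h1 := congrArg r (Ring.inverse_mul_cancel _ hu)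
      have h2 : r (Ring.inverse (w * x.1)) = 0 := by linear_combination -hx1
      rw [map_mul, h2, map_one, zero_mul] at h1
      exact zero_ne_one h1
  · rintro y z ⟨A, x⟩
    have h0 : π ^ 3 * (π ^ (k - 4)) ^ 2 = 0 := by
      rw [← pow_mul, ← pow_add, h.pow_eq_zero (by omega)]
    have h4 : π ^ (j + 1) * π ^ (k - 4) = 0 := by rw [← pow_add, h.pow_eq_zero (by omega)]
    have hinv := h.inverse_mul_one_add (e := 3) (m := k - 4) (by omega) (by omega) y
    have hki : π ^ (k - 1) = π ^ 3 * π ^ (k - 4) := by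
      rw [← pow_add]; congr 1; omega
    simp only [Equiv.prodCongr_apply, Prod.map_apply, Units.mulRight_apply,
      IsUnit.unit_spec, Equiv.coe_addRight]
    rw [mul_assoc (χ _ ^ k), ← AddChar.map_add_eq_mul, ← mul_assoc w A, Ring.mul_inverse_rev (w * A),
      hki, map_mul r, h.map_one_add (by omega), mul_one]
    congr 2
    linear_combination (Ring.inverse (w * A)) * hinv + B * z * h4 +
        (A * w ^ 2) * (3 * x ^ 2 * y * z + 3 * x * z ^ 2 + 3 * x * y * z ^ 2 * π ^ (k - 4) +
          z ^ 3 * π ^ (k - 4) + y * z ^ 3 * (π ^ (k - 4)) ^ 2) * h0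

/-- The substitution A = -27B⁻³α, x = B²(9w)⁻¹ξ reduces the phase to the normalized one with v =
B³(27w)⁻¹. -/
theorem truncatedCubicSum_of_eq_two (hχ : χ ^ 3 = 1) {ω : R} (hω : ω ^ 2 + ω + 1 = 0)
    (hw : r w ≠ 0) (hB : r B ≠ 0) (hj : j = 2) (hk : 5 ≤ k) :
    truncatedCubicSum r ψ χ π w B j k = (Fintype.card F : ℂ) ^ (k + 2) *
      ψ (π ^ 3 * (B ^ 3 * Ring.inverse (3 ^ 3 * w))) := by
  have hq : (Fintype.card F : ℂ) ≠ 0 := by simp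
  refine mul_left_cancel₀ hq ?_
  rw [h.card_mul_truncatedCubicSum hψ χ h3 hw (by omega) (by omega)]
  obtain ⟨b, hb⟩ := ((h.isUnit_iff B).mpr hB).exists_right_inv
  obtain ⟨w', hw'⟩ := ((h.isUnit_iff w).mpr hw).exists_right_inv
  obtain ⟨t, ht⟩ := ((h.isUnit_iff 3).mpr (by rwa [map_ofNat])).exists_right_inv
  have hv : B ^ 3 * Ring.inverse (3 ^ 3 * w) = B ^ 3 * t ^ 3 * w' := by
    have h1 : (3 ^ 3 * w) * (t ^ 3 * w') = 1 := by
      linear_combination (3 ^ 3 * t ^ 3) * hw' + (9 * t ^ 2 + 3 * t + 1) * ht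
    have hu : IsUnit (3 ^ 3 * w) := .of_mul_eq_one _ h1
    have h2 := Ring.inverse_mul_cancel _ hu
    linear_combination (B ^ 3 * t ^ 3 * w') * h2 - B ^ 3 * Ring.inverse (3 ^ 3 * w) * h1
  have hvu : IsUnit (B ^ 3 * t ^ 3 * w') := by
    refine .of_mul_eq_one (b ^ 3 * 3 ^ 3 * w) ?_
    calc B ^ 3 * t ^ 3 * w' * (b ^ 3 * 3 ^ 3 * w) = (B * b) ^ 3 * (3 * t) ^ 3 * (w * w') := by ring
      _ = 1 := by rw [hb, ht, hw']; ring
  rw [hv]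
  have hmain := h.sum_stationary_phase hψ χ h3 hω hvu hk
  have hu₁ : -27 * b ^ 3 * -(t ^ 3 * B ^ 3) = 1 := by
    calc -27 * b ^ 3 * -(t ^ 3 * B ^ 3) = (B * b) ^ 3 * (3 * t) ^ 3 := by ring
      _ = 1 := by rw [hb, ht]; ring
  have hu₂ : B ^ 2 * t ^ 2 * w' * (b ^ 2 * 3 ^ 2 * w) = 1 := by
    calc B ^ 2 * t ^ 2 * w' * (b ^ 2 * 3 ^ 2 * w) = (B * b) ^ 2 * (3 * t) ^ 2 * (w * w') := by ring
      _ = 1 := by rw [hb, ht, hw']; ring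
  -- The units u₁, u₂ are fixed by (wu₁)⁻¹ = -v, u₁w²u₂³ = -v and Bu₂ = 3v. Moreover u₁ = (-3B⁻¹)³
  -- is a cube, so χ does not see it.
  obtain ⟨u₁, hu₁'⟩ := IsUnit.of_mul_eq_one _ hu₁
  obtain ⟨u₂, hu₂'⟩ := IsUnit.of_mul_eq_one _ hu₂
  have hphase : ∀ α ξ, χ (r (u₁ * α)) ^ k * ψ (π ^ 3 * (Ring.inverse (w * (u₁ * α)) +
      u₁ * α * w ^ 2 * (u₂ * ξ) ^ 3) + π ^ (j + 1) * B * (u₂ * ξ)) =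
      χ (r α) ^ k * ψ (π ^ 3 * (B ^ 3 * t ^ 3 * w') * (3 * ξ - α * ξ ^ 3 - Ring.inverse α)) := by
    intro α ξ
    have hχu : χ (r (u₁ * α)) = χ (r α) := by
      rw [hu₁', show -27 * b ^ 3 * α = (-3 * b) ^ 3 * α by ring, map_mul, map_pow,
        MulChar.apply_pow_three_mul hχ]
      intro h0
      have h1 := congrArg r hb
      rw [map_mul, map_one] at h1
      rw [map_mul, map_neg, map_ofNat, neg_mul, neg_eq_zero, mul_eq_zero] at h0
      rw [h0.resolve_left h3, mul_zero] at h1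
      exact zero_ne_one h1
    have hinv : Ring.inverse (w * (u₁ * α)) = -(B ^ 3 * t ^ 3 * w') * Ring.inverse α := by
      have h1 : w * u₁ * -(B ^ 3 * t ^ 3 * w') = 1 := by
        rw [hu₁']
        linear_combination hu₁ + (-27 * b ^ 3 * -(t ^ 3 * B ^ 3)) * hw'
      have hu : IsUnit (w * u₁) := .of_mul_eq_one _ h1
      have h2 := Ring.inverse_mul_cancel _ hu
      rw [← mul_assoc, Ring.mul_inverse_rev]
      linear_combination (-(B ^ 3 * t ^ 3 * w') * Ring.inverse α) * h2 -
        (Ring.inverse α * Ring.inverse (w * u₁)) * h1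
    have h₁ : (u₁ : R) * w ^ 2 * (u₂ : R) ^ 3 = -(B ^ 3 * t ^ 3 * w') := by
      rw [hu₁', hu₂']
      calc _ = -((B * b) ^ 3 * (3 * t) ^ 3 * (w * w') ^ 2 * (B ^ 3 * t ^ 3 * w')) := by ring
        _ = _ := by rw [hb, ht, hw']; ring
    have h₂ : B * (u₂ : R) = 3 * (B ^ 3 * t ^ 3 * w') := by
      rw [hu₂']
      linear_combination (-(B ^ 3 * t ^ 2 * w')) * ht
    rw [hχu, hinv, hj]
    congr 2
    linear_combination (π ^ 3 * α * ξ ^ 3) * h₁ + (π ^ 3 * ξ) * h₂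
  rw [← Equiv.sum_comp u₁.mulLeft]
  simp only [Units.mulLeft_apply]
  have hx : ∀ α, ∑ x, χ (r (u₁ * α)) ^ k * ψ (π ^ 3 * (Ring.inverse (w * (u₁ * α)) +
      u₁ * α * w ^ 2 * x ^ 3) + π ^ (j + 1) * B * x) =
      ∑ ξ, χ (r α) ^ k *
        ψ (π ^ 3 * (B ^ 3 * t ^ 3 * w') * (3 * ξ - α * ξ ^ 3 - Ring.inverse α)) := by
    intro α
    rw [← Equiv.sum_comp u₂.mulLeft]
    exact Finset.sum_congr rfl fun ξ _ => hphase α ξ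
  rw [Finset.sum_congr rfl fun α _ => hx α, hmain]
  ring

end IsTruncatedDVR

/-- Since π = 0, only the cubic phase remains. Summing over A first, x = 0 gives ∑ χ = 0 and each x
≠ 0 gives χ(w)g, because (w²x³)⁻¹ is w times a cube. -/
theorem truncatedCubicSum_one {r : R →+* F} {ψ : AddChar R ℂ} {χ : MulChar F ℂ} {π w B : R}
    {j : ℕ} (hχ : χ ^ 3 = 1) (hχ1 : χ ≠ 1) (hr : Function.Bijective r) (hπ : π = 0)
    {ψ' : AddChar F ℂ} (hψ' : ∀ x, ψ x = ψ' (r x)) (hw : r w ≠ 0) (hj : 1 ≤ j) :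
    truncatedCubicSum r ψ χ π w B j 1 =
      Nat.card Fˣ * χ (r w) * gaussSum χ ψ' := by
  classical
  let e := RingEquiv.ofBijective r hr
  have hinner : ∀ x : F, ∑ a : F, χ a * ψ' (a * r w ^ 2 * x ^ 3) =
      if x = 0 then 0 else χ (r w) * gaussSum χ ψ' := by
    intro x
    split_ifs with hx
    · simp [hx, MulChar.sum_eq_zero_of_ne_one hχ1]
    · have ha : (r w ^ 2 * x ^ 3)⁻¹ ≠ 0 := by simp [hw, hx]
      have hχa : χ (r w ^ 2 * x ^ 3)⁻¹ = χ (r w) := by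
        rw [← MulChar.apply_pow_three_mul hχ (a := r w * x) (by simp [hw, hx])
          (b := (r w ^ 2 * x ^ 3)⁻¹)]
        congr 1
        field_simp
      rw [sum_mulChar_mul_comp_mul_left χ ha, hχa, gaussSum]
      congr 1
      refine Finset.sum_congr rfl fun a _ => ?_
      congr 2
      field_simp
  have h1 : truncatedCubicSum r ψ χ π w B j 1 =
      ∑ a : F, ∑ x : F, χ a * ψ' (a * r w ^ 2 * x ^ 3) := by
    rw [truncatedCubicSum, ← Equiv.sum_comp e.toEquiv]
    refine Finset.sum_congr rfl fun A _ => ?_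
    rw [hπ, zero_pow (by norm_num), zero_pow (by omega), zero_mul, AddChar.map_zero_eq_one,
      one_mul, Finset.mul_sum, ← Equiv.sum_comp e.toEquiv]
    refine Finset.sum_congr rfl fun x _ => ?_
    simp [hψ', e]
  rw [h1, Finset.sum_comm, Finset.sum_congr rfl fun x _ => hinner x, Finset.sum_ite]
  simp only [Finset.sum_const_zero, zero_add, Finset.sum_const, nsmul_eq_mul]
  rw [mul_assoc]
  congr 2
  rw [Nat.card_eq_fintype_card, Fintype.card_units, Finset.filter_ne' Finset.univ (0 : F),
    Finset.card_erase_of_mem (Finset.mem_univ _), Finset.card_univ]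

theorem norm_gaussSum_sq [DecidableEq F] {χ : MulChar F ℂ} (hχ1 : χ ≠ 1) {ψ : AddChar F ℂ}
    (hψ : ψ.IsPrimitive) : ‖gaussSum χ ψ‖ ^ 2 = Fintype.card F := by
  have h := gaussSum_mul_gaussSum_eq_card hχ1 hψ
  have h2 := star_gaussSum_eq χ ψ
  rw [← h2] at h
  have h3 : ((‖gaussSum χ ψ‖ ^ 2 : ℝ) : ℂ) = Fintype.card F := by
    rw [← h, ← Complex.normSq_eq_norm_sq, ← Complex.mul_conj]
    rfl
  exact_mod_cast h3

end Truncated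
end

noncomputable section

variable {K : Type*} [Field K]

/-! ### Quotients of the ring of integers and their additive characters -/

section Reduction

variable {p : 𝓞 K}

/-- The reduction map from `𝓞 K / p ^ k` to `𝓞 K / p ^ m`. -/
def reductionPow (p : 𝓞 K) {m k : ℕ} (h : m ≤ k) :
    𝓞 K ⧸ Ideal.span {p ^ k} →+* 𝓞 K ⧸ Ideal.span {p ^ m} :=
  Ideal.Quotient.factor (Ideal.span_singleton_le_span_singleton.mpr (pow_dvd_pow p h))

/-- The reduction map from `𝓞 K / p ^ k` to `𝓞 K / p`. -/
def reduction (p : 𝓞 K) {k : ℕ} (h : 1 ≤ k) :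
    𝓞 K ⧸ Ideal.span {p ^ k} →+* 𝓞 K ⧸ Ideal.span {p} :=
  Ideal.Quotient.factor
    (Ideal.span_singleton_le_span_singleton.mpr (dvd_pow_self p (by omega)))

theorem reductionPow_mk {m k : ℕ} (h : m ≤ k) (a : 𝓞 K) :
    reductionPow p h (Ideal.Quotient.mk _ a) = Ideal.Quotient.mk _ a := rfl

theorem reduction_mk {k : ℕ} (h : 1 ≤ k) (a : 𝓞 K) :
    reduction p h (Ideal.Quotient.mk _ a) = Ideal.Quotient.mk _ a := rfl

theorem mk_span_eq_zero_iff {c a : 𝓞 K} :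
    Ideal.Quotient.mk (Ideal.span {c}) a = 0 ↔ c ∣ a := by
  rw [Ideal.Quotient.eq_zero_iff_mem, Ideal.mem_span_singleton]

theorem mk_pow_dvd_mk_iff {m k : ℕ} (h : m ≤ k) {a : 𝓞 K} :
    Ideal.Quotient.mk (Ideal.span {p ^ k}) p ^ m ∣ Ideal.Quotient.mk _ a ↔ p ^ m ∣ a := by
  constructor
  · rintro ⟨x, hx⟩
    obtain ⟨c, rfl⟩ := Ideal.Quotient.mk_surjective x
    rw [← map_pow, ← map_mul, Ideal.Quotient.eq, Ideal.mem_span_singleton] at hx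
    have := (pow_dvd_pow p h).trans hx
    exact (dvd_sub_left (dvd_mul_right _ _)).mp this
  · rintro ⟨c, rfl⟩
    rw [map_mul, map_pow]
    exact dvd_mul_right _ _

end Reduction

variable [NumberField K]

section AdditiveCharacter

variable [IsCyclotomicExtension {3} ℚ K] (φ : K →+* ℂ) {δ : K}

theorem exists_rat_add_rat_mul_zeta (x : K) :
    ∃ u v : ℚ, x = u + v * IsCyclotomicExtension.zeta 3 ℚ K := by
  have hζ := IsCyclotomicExtension.zeta_spec 3 ℚ K
  set ζ := IsCyclotomicExtension.zeta 3 ℚ K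
  have hq : ζ ^ 2 + ζ + 1 = 0 := eta_relation hζ
  have hx : x ∈ Algebra.adjoin ℚ {ζ} := by
    rw [IsCyclotomicExtension.adjoin_primitive_root_eq_top hζ]
    trivial
  induction hx using Algebra.adjoin_induction with
  | mem y hy => exact ⟨0, 1, by simpa using hy⟩
  | algebraMap r => exact ⟨r, 0, by simp⟩
  | add y z _ _ hy hz =>
    obtain ⟨a, b, h1⟩ := hy
    obtain ⟨c, d, h2⟩ := hz
    exact ⟨a + c, b + d, by rw [h1, h2]; push_cast; ring⟩
  | mul y z _ _ hy hz =>
    obtain ⟨a, b, h1⟩ := hy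
    obtain ⟨c, d, h2⟩ := hz
    refine ⟨a * c - b * d, a * d + b * c - b * d, ?_⟩
    rw [h1, h2]
    push_cast
    linear_combination (b * d : K) * hq

/-- As δ = ±(2ζ + 1) and conjugation negates δ, the trace of (u + vζ)/δ is v(ζ - ζ')/δ = ±v; the
sign depends on the choice of δ. -/
theorem exists_eisExp_rat (hδ : δ ^ 2 = -3) :
    ∃ ε : ℤ, ε ^ 2 = 1 ∧ ∀ u v : ℚ, eisExp φ δ (u + v * IsCyclotomicExtension.zeta 3 ℚ K) =
      Complex.exp (2 * Real.pi * Complex.I * (ε * v)) := by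
  have hζ := IsCyclotomicExtension.zeta_spec 3 ℚ K
  set ζ := IsCyclotomicExtension.zeta 3 ℚ K
  have hq : ζ ^ 2 + ζ + 1 = 0 := eta_relation hζ
  have hδ0 : φ δ ≠ 0 := by
    rw [map_ne_zero]
    rintro rfl
    norm_num at hδ
  have hz3 : φ ζ ^ 3 = 1 := by rw [← map_pow, hζ.pow_eq_one, map_one]
  have hz2 : φ ζ ^ 2 + φ ζ + 1 = 0 := by
    have := congrArg φ hq
    simpa using this
  have hn : ‖φ ζ‖ = 1 := Complex.norm_eq_one_of_pow_eq_one hz3 (by norm_num)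
  have hc : starRingEnd ℂ (φ ζ) = -1 - φ ζ := by
    have h1 : φ ζ * starRingEnd ℂ (φ ζ) = 1 := by
      rw [Complex.mul_conj, Complex.normSq_eq_norm_sq, hn]; norm_num
    linear_combination (φ ζ) ^ 2 * h1 + (-starRingEnd ℂ (φ ζ)) * hz3 + hz2
  have hs : ∃ ε : ℤ, ε ^ 2 = 1 ∧ φ δ = ε * (2 * φ ζ + 1) := by
    have : φ δ = 2 * φ ζ + 1 ∨ φ δ = -(2 * φ ζ + 1) := by
      apply sq_eq_sq_iff_eq_or_eq_neg.mp
      rw [← map_pow, hδ, map_neg, map_ofNat]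
      linear_combination (-4 : ℂ) * hz2
    rcases this with h | h
    · exact ⟨1, by norm_num, by rw [h]; push_cast; ring⟩
    · exact ⟨-1, by norm_num, by rw [h]; push_cast; ring⟩
  obtain ⟨ε, hε, hs⟩ := hs
  refine ⟨ε, hε, fun u v => ?_⟩
  have hεc : (ε : ℂ) ^ 2 = 1 := by exact_mod_cast hε
  rw [eisExp]
  congr 2
  have hcδ : starRingEnd ℂ (φ δ) = -φ δ := by
    rw [hs]
    simp only [map_mul, map_add, hc, map_intCast, map_ofNat, map_one]
    ring
  simp only [map_div₀, map_add, map_mul, map_ratCast, hc, hcδ]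
  field_simp
  rw [hs]
  linear_combination (-(v : ℂ) * (2 * φ ζ + 1)) * hεc

/-- In other words, δ⁻¹𝒪 is its own trace dual up to the factor δ⁻¹: δ generates the different.
Testing y = 1 gives v ∈ ℤ, and y = ζ gives u - v ∈ ℤ, since xζ = -v + (u - v)ζ. -/
theorem exists_integer_of_eisExp_eq_one (hδ : δ ^ 2 = -3) {x : K}
    (h : ∀ y : 𝓞 K, eisExp φ δ (x * y) = 1) : ∃ z : 𝓞 K, x = z := by
  obtain ⟨ε, hε, he⟩ := exists_eisExp_rat φ hδ
  have hζ := IsCyclotomicExtension.zeta_spec 3 ℚ K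
  obtain ⟨u, v, hx⟩ := exists_rat_add_rat_mul_zeta x
  set ζ := IsCyclotomicExtension.zeta 3 ℚ K
  have hζc : (hζ.toInteger : K) = ζ := hζ.coe_toInteger
  have hq : ζ ^ 2 + ζ + 1 = 0 := eta_relation hζ
  have hint : ∀ u v : ℚ, eisExp φ δ (u + v * ζ) = 1 → ∃ n : ℤ, v = n := by
    intro u v h1
    rw [he, Complex.exp_eq_one_iff] at h1
    obtain ⟨n, hn⟩ := h1
    have h2 : (ε : ℂ) * v = n := by
      have h3 : (2 * Real.pi * Complex.I : ℂ) ≠ 0 := Complex.two_pi_I_ne_zero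
      exact mul_left_cancel₀ h3 (by linear_combination hn)
    have h4 : (ε : ℚ) * v = n := by exact_mod_cast h2
    have h5 : (ε : ℚ) ^ 2 = 1 := by exact_mod_cast hε
    refine ⟨ε * n, ?_⟩
    push_cast
    linear_combination (ε : ℚ) * h4 - v * h5
  obtain ⟨n, hn⟩ := hint u v (by rw [← hx]; simpa using h 1)
  obtain ⟨m, hm⟩ := hint (-v) (u - v) (by
    rw [← h hζ.toInteger, hζc, hx]
    congr 1
    push_cast
    linear_combination (-v : K) * hq)
  refine ⟨((m + n : ℤ) : 𝓞 K) + (n : ℤ) * hζ.toInteger, ?_⟩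
  have hu : u = ((m + n : ℤ) : ℚ) := by push_cast; linear_combination hm + hn
  rw [hx, hu, hn]
  simp [hζc]

/-- The additive character `a ↦ e(a / c)` of `𝓞 K / c`. -/
def eisAddChar (hδ : δ ^ 2 = -3) {c : 𝓞 K} (hc : c ≠ 0) :
    AddChar (𝓞 K ⧸ Ideal.span {c}) ℂ where
  toFun := eisExpMod φ δ c
  map_zero_eq_one' := by
    rw [← map_zero (Ideal.Quotient.mk _), eisExpMod_mk φ hδ hc]
    simp [eisExp]
  map_add_eq_mul' x y := by
    obtain ⟨a, rfl⟩ := Ideal.Quotient.mk_surjective x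
    obtain ⟨b, rfl⟩ := Ideal.Quotient.mk_surjective y
    rw [← map_add, eisExpMod_mk φ hδ hc, eisExpMod_mk φ hδ hc, eisExpMod_mk φ hδ hc, ← eisExp_add]
    congr 1
    simp [add_div]

theorem eisAddChar_apply (hδ : δ ^ 2 = -3) {c : 𝓞 K} (hc : c ≠ 0) (x : 𝓞 K ⧸ Ideal.span {c}) :
    eisAddChar φ hδ hc x = eisExpMod φ δ c x := rfl

theorem eisAddChar_isPrimitive (hδ : δ ^ 2 = -3) {c : 𝓞 K} (hc : c ≠ 0) :
    (eisAddChar φ hδ hc).IsPrimitive := by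
  intro x hx h1
  obtain ⟨a, rfl⟩ := Ideal.Quotient.mk_surjective x
  have hcK : (c : K) ≠ 0 := by simpa using hc
  obtain ⟨z, hz⟩ := exists_integer_of_eisExp_eq_one φ hδ (x := (a : K) / c) (by
    intro y
    have := DFunLike.congr_fun h1 (Ideal.Quotient.mk _ y)
    rw [AddChar.mulShift_apply, AddChar.one_apply, ← map_mul, eisAddChar_apply,
      eisExpMod_mk φ hδ hc] at this
    rw [← this]
    congr 1
    push_cast
    ring)
  apply hx
  rw [Ideal.Quotient.eq_zero_iff_mem, Ideal.mem_span_singleton]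
  refine ⟨z, RingOfIntegers.ext ?_⟩
  rw [div_eq_iff hcK] at hz
  push_cast
  rw [hz, mul_comm]

end AdditiveCharacter

section Residue

variable {p : 𝓞 K}

theorem finite_quotient_span {c : 𝓞 K} (hc : c ≠ 0) : Finite (𝓞 K ⧸ Ideal.span {c}) :=
  Ideal.finiteQuotientOfFreeOfNeBot _ (by simpa using hc)

theorem card_quotient_span_pow (p : 𝓞 K) (n : ℕ) :
    Nat.card (𝓞 K ⧸ Ideal.span {p ^ n}) = eisNorm p ^ n := by
  rw [eisNorm, ← map_pow, Ideal.span_singleton_pow, Ideal.absNorm_apply, Submodule.cardQuot_apply]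

theorem card_quotient_span (p : 𝓞 K) : Nat.card (𝓞 K ⧸ Ideal.span {p}) = eisNorm p := by
  rw [eisNorm, Ideal.absNorm_apply, Submodule.cardQuot_apply]

/-- The residue field of a prime element. -/
@[reducible] def residueField (hp : Prime p) : Field (𝓞 K ⧸ Ideal.span {p}) :=
  haveI : (Ideal.span {p}).IsMaximal := ((Ideal.span_singleton_prime hp.ne_zero).mpr hp).isMaximal
    (by simpa using hp.ne_zero)
  Ideal.Quotient.field (Ideal.span {p})

/-- The annihilator of p^m is the kernel of reduction modulo p^(k-m), so its order is q^k / q^(k-m).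
-/
theorem isTruncatedDVR_reduction (hp : Prime p) {k : ℕ} (hk : 1 ≤ k)
    [Fintype (𝓞 K ⧸ Ideal.span {p ^ k})] [Fintype (𝓞 K ⧸ Ideal.span {p})] :
    letI := residueField hp
    IsTruncatedDVR (reduction p hk) (Ideal.Quotient.mk (Ideal.span {p ^ k}) p) k := by
  let _ := residueField hp
  have hzero : ∀ m ≤ k, ∀ y, Ideal.Quotient.mk (Ideal.span {p ^ k}) p ^ m * y = 0 ↔
      Ideal.Quotient.mk (Ideal.span {p ^ k}) p ^ (k - m) ∣ y := by
    intro m hm y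
    obtain ⟨a, rfl⟩ := Ideal.Quotient.mk_surjective y
    rw [mk_pow_dvd_mk_iff (Nat.sub_le _ _), ← map_pow, ← map_mul, mk_span_eq_zero_iff]
    nth_rw 1 [← Nat.add_sub_of_le hm]
    rw [pow_add, mul_dvd_mul_iff_left (pow_ne_zero _ hp.ne_zero)]
  refine ⟨Ideal.Quotient.factor_surjective _, ?_, hzero, ?_⟩
  · intro x
    obtain ⟨a, rfl⟩ := Ideal.Quotient.mk_surjective x
    have := mk_pow_dvd_mk_iff (p := p) hk (a := a)
    rw [pow_one, pow_one] at this
    rw [reduction_mk, mk_span_eq_zero_iff, this]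
  · classical
    intro m hm
    have := finite_quotient_span (pow_ne_zero (k - m) hp.ne_zero)
    let _ := Fintype.ofFinite (𝓞 K ⧸ Ideal.span {p ^ (k - m)})
    have h1 := sum_comp_addMonoidHom (reductionPow p (Nat.sub_le k m)).toAddMonoidHom
      (fun _ => (1 : ℂ))
    have hsurj : ∀ b, ∃ a, (reductionPow p (Nat.sub_le k m)).toAddMonoidHom a = b :=
      Ideal.Quotient.factor_surjective
        (Ideal.span_singleton_le_span_singleton.mpr (pow_dvd_pow p (Nat.sub_le k m)))
    have hf : (Finset.univ.filter fun a =>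
        (reductionPow p (Nat.sub_le k m)).toAddMonoidHom a = 0) =
        Finset.univ.filter fun y => Ideal.Quotient.mk (Ideal.span {p ^ k}) p ^ m * y = 0 := by
      ext y
      rw [Finset.mem_filter_univ, Finset.mem_filter_univ, hzero m hm]
      obtain ⟨a, rfl⟩ := Ideal.Quotient.mk_surjective y
      rw [mk_pow_dvd_mk_iff (Nat.sub_le _ _)]
      exact mk_span_eq_zero_iff
    rw [Finset.filter_true_of_mem fun b _ => hsurj b] at h1
    simp only [Finset.sum_const, nsmul_eq_mul, mul_one, Finset.card_univ] at h1
    rw [← Nat.card_eq_fintype_card, ← Nat.card_eq_fintype_card, card_quotient_span_pow,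
      card_quotient_span_pow] at h1
    have hq : eisNorm p ≠ 0 := by
      rw [← card_quotient_span, Nat.card_eq_fintype_card]
      exact Fintype.card_ne_zero
    rw [← Nat.card_eq_fintype_card (α := 𝓞 K ⧸ Ideal.span {p}), card_quotient_span]
    refine Nat.eq_of_mul_eq_mul_right (Nat.pos_of_ne_zero (pow_ne_zero (k - m) hq)) ?_
    rw [← pow_add, Nat.add_sub_of_le hm]
    rw [hf] at h1
    exact_mod_cast h1.symm

end Residue
end

noncomputable section

variable {K : Type*} [Field K] [NumberField K]

/-! ### The cubic residue symbol as a character of order three -/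

section CubicCharacter

variable {p : 𝓞 K}

theorem exists_cube_root_of_unity [IsCyclotomicExtension {3} ℚ K] :
    ∃ η : 𝓞 K, η ^ 2 + η + 1 = 0 := by
  have h := IsCyclotomicExtension.zeta_spec 3 ℚ K
  refine ⟨h.toInteger, RingOfIntegers.ext ?_⟩
  have h1 : (h.toInteger : K) = IsCyclotomicExtension.zeta 3 ℚ K := h.coe_toInteger
  simpa [h1] using eta_relation h

theorem three_dvd_eisNorm_sub_one [IsCyclotomicExtension {3} ℚ K] (hp : Prime p)
    (hp3 : ¬ p ∣ 3) : 3 ∣ eisNorm p - 1 := by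
  let _ := residueField hp
  have := finite_quotient_span hp.ne_zero
  let _ := Fintype.ofFinite (𝓞 K ⧸ Ideal.span {p})
  obtain ⟨η, hη⟩ := exists_cube_root_of_unity (K := K)
  have hη' := congrArg (Ideal.Quotient.mk (Ideal.span {p})) hη
  simp only [map_add, map_pow, map_one, map_zero] at hη'
  set x := Ideal.Quotient.mk (Ideal.span {p}) η
  have hx3 : x ^ 3 = 1 := by linear_combination (x - 1) * hη'
  have hx1 : x ≠ 1 := by
    intro h1
    apply hp3
    rw [← mk_span_eq_zero_iff, map_ofNat]
    rw [h1] at hη'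
    linear_combination hη'
  have : Fact (Nat.Prime 3) := ⟨Nat.prime_three⟩
  rw [← orderOf_eq_prime hx3 hx1, ← card_quotient_span, Nat.card_eq_fintype_card]
  apply orderOf_dvd_of_pow_eq_one
  apply FiniteField.pow_card_sub_one_eq_one
  rintro h0
  rw [h0] at hx3
  norm_num at hx3

theorem one_lt_eisNorm (hp : Prime p) : 1 < eisNorm p := by
  let _ := residueField hp
  have := finite_quotient_span hp.ne_zero
  rw [← card_quotient_span]
  exact Finite.one_lt_card

theorem cubicSymbol_one (φ : K →+* ℂ) (hp3 : ¬ p ∣ 3) : cubicSymbol φ p 1 = 1 := by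
  rw [cubicSymbol_eq φ hp3 (ζ := 1) (by norm_num) (by simp)]
  simp

theorem cubicSymbol_out_mk (φ : K →+* ℂ) (a : 𝓞 K) :
    cubicSymbol φ p (Quotient.out (Ideal.Quotient.mk (Ideal.span {p}) a)) = cubicSymbol φ p a := by
  apply cubicSymbol_congr
  rw [← Ideal.mem_span_singleton, ← Ideal.Quotient.eq]
  exact Quotient.out_eq _

theorem eisMoebius_eq_neg_one (hp : Prime p) : eisMoebius p = -1 := by
  have hP : Prime (Ideal.span {p}) := by
    refine Ideal.prime_of_isPrime (by simpa using hp.ne_zero) ?_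
    exact (Ideal.span_singleton_prime hp.ne_zero).mpr hp
  rw [eisMoebius, if_pos hP.irreducible.squarefree,
    UniqueFactorizationMonoid.normalizedFactors_irreducible hP.irreducible]
  simp

variable [IsCyclotomicExtension {3} ℚ K] (φ : K →+* ℂ)

/-- The exponent (N(p) - 1)/3 is positive, so p divides the power of a; a root of unity congruent to
it would be a unit divisible by p. -/
theorem cubicSymbol_eq_zero (hp : Prime p) (hp3 : ¬ p ∣ 3) {a : 𝓞 K} (ha : p ∣ a) :
    cubicSymbol φ p a = 0 := by
  rw [cubicSymbol, dif_neg]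
  rintro ⟨ζ, hζ, h⟩
  have h1 := one_lt_eisNorm hp
  have h2 := three_dvd_eisNorm_sub_one hp hp3
  have h3 : p ∣ a ^ ((eisNorm p - 1) / 3) := ha.trans (dvd_pow_self a (by omega))
  exact hp.not_isUnit (isUnit_of_dvd_unit ((dvd_sub_right h3).mp h)
    (IsUnit.of_pow_eq_one hζ (by norm_num)))

theorem cubicSymbol_mul (hp : Prime p) (hp3 : ¬ p ∣ 3) (a b : 𝓞 K) :
    cubicSymbol φ p (a * b) = cubicSymbol φ p a * cubicSymbol φ p b := by
  by_cases ha : p ∣ a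
  · rw [cubicSymbol_eq_zero φ hp hp3 ha, cubicSymbol_eq_zero φ hp hp3 (ha.mul_right b), zero_mul]
  by_cases hb : p ∣ b
  · rw [cubicSymbol_eq_zero φ hp hp3 hb, cubicSymbol_eq_zero φ hp hp3 (hb.mul_left a), mul_zero]
  obtain ⟨ζ, hζ, h1⟩ := exists_cubicSymbol hp hp3 ha
  obtain ⟨ξ, hξ, h2⟩ := exists_cubicSymbol hp hp3 hb
  rw [cubicSymbol_eq φ hp3 hζ h1, cubicSymbol_eq φ hp3 hξ h2,
    cubicSymbol_eq φ hp3 (ζ := ζ * ξ) (by rw [mul_pow, hζ, hξ, one_mul])]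
  · simp
  · obtain ⟨c, hc⟩ := h1
    obtain ⟨d, hd⟩ := h2
    refine ⟨c * b ^ ((eisNorm p - 1) / 3) + ζ * d, ?_⟩
    rw [mul_pow]
    linear_combination b ^ ((eisNorm p - 1) / 3) * hc + ζ * hd

/-- The cubic residue symbol as a character of the residue field. -/
def cubicChar (hp : Prime p) (hp3 : ¬ p ∣ 3) : MulChar (𝓞 K ⧸ Ideal.span {p}) ℂ where
  toFun x := cubicSymbol φ p (Quotient.out x)
  map_one' := by
    rw [← map_one (Ideal.Quotient.mk _), cubicSymbol_out_mk, cubicSymbol_one φ hp3]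
  map_mul' x y := by
    obtain ⟨a, rfl⟩ := Ideal.Quotient.mk_surjective x
    obtain ⟨b, rfl⟩ := Ideal.Quotient.mk_surjective y
    rw [← map_mul, cubicSymbol_out_mk, cubicSymbol_out_mk, cubicSymbol_out_mk,
      cubicSymbol_mul φ hp hp3]
  map_nonunit' x hx := by
    obtain ⟨a, rfl⟩ := Ideal.Quotient.mk_surjective x
    rw [cubicSymbol_out_mk]
    apply cubicSymbol_eq_zero φ hp hp3
    by_contra ha
    let _ := residueField hp
    rw [← mk_span_eq_zero_iff] at ha
    exact hx (Ne.isUnit ha)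

theorem cubicChar_mk (hp : Prime p) (hp3 : ¬ p ∣ 3) (a : 𝓞 K) :
    cubicChar φ hp hp3 (Ideal.Quotient.mk _ a) = cubicSymbol φ p a := cubicSymbol_out_mk φ a

theorem cubicChar_pow_three (hp : Prime p) (hp3 : ¬ p ∣ 3) : cubicChar φ hp hp3 ^ 3 = 1 := by
  let _ := residueField hp
  ext u
  rw [MulChar.pow_apply_coe, MulChar.one_apply_coe]
  obtain ⟨a, ha⟩ := Ideal.Quotient.mk_surjective (u : 𝓞 K ⧸ Ideal.span {p})
  have hpa : ¬ p ∣ a := by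
    rw [← mk_span_eq_zero_iff, ha]
    exact u.ne_zero
  obtain ⟨ζ, hζ, h1⟩ := exists_cubicSymbol hp hp3 hpa
  rw [← ha, cubicChar_mk, cubicSymbol_eq φ hp3 hζ h1, ← map_pow, ← map_pow, hζ]
  simp

/-- A generator γ has order N(p) - 1, so γ^((N(p) - 1)/3) ≠ 1. -/
theorem cubicChar_ne_one (hp : Prime p) (hp3 : ¬ p ∣ 3) : cubicChar φ hp hp3 ≠ 1 := by
  let _ := residueField hp
  have := finite_quotient_span hp.ne_zero
  intro h
  obtain ⟨γ, hγ⟩ := IsCyclic.exists_generator (α := (𝓞 K ⧸ Ideal.span {p})ˣ)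
  obtain ⟨a, ha⟩ := Ideal.Quotient.mk_surjective (γ : 𝓞 K ⧸ Ideal.span {p})
  have hpa : ¬ p ∣ a := by
    rw [← mk_span_eq_zero_iff, ha]
    exact γ.ne_zero
  obtain ⟨ζ, hζ, h1⟩ := exists_cubicSymbol hp hp3 hpa
  have h2 : cubicChar φ hp hp3 γ = 1 := by rw [h, MulChar.one_apply_coe]
  rw [← ha, cubicChar_mk, cubicSymbol_eq φ hp3 hζ h1] at h2
  have h3 : ζ = 1 := by
    apply RingOfIntegers.ext
    apply φ.injective
    rw [h2]
    simp
  rw [h3, ← mk_span_eq_zero_iff, map_sub, map_pow, ha, map_one, sub_eq_zero] at h1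
  have h4 : γ ^ ((eisNorm p - 1) / 3) = 1 := Units.ext (by simpa using h1)
  have h5 := orderOf_dvd_of_pow_eq_one h4
  have h6 : orderOf γ = eisNorm p - 1 := by
    rw [orderOf_eq_card_of_forall_mem_zpowers hγ, Nat.card_units, card_quotient_span]
  rw [h6] at h5
  have h7 := one_lt_eisNorm hp
  have h8 := three_dvd_eisNorm_sub_one hp hp3
  have := Nat.le_of_dvd (by omega) h5
  omega

end CubicCharacter

theorem sum_units_eq_sum {R : Type*} [CommRing R] [Fintype R] [Fintype Rˣ] (f : R → ℂ)
    (hf : ∀ x, ¬ IsUnit x → f x = 0) : ∑ u : Rˣ, f u = ∑ x, f x :=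
  Fintype.sum_of_injective _ Units.val_injective _ _ hf fun _ => rfl

/-! ### Translation to truncated discrete valuation rings -/

section Evaluation

variable [IsCyclotomicExtension {3} ℚ K] (φ : K →+* ℂ) {δ : K} (hδ : δ ^ 2 = -3)
  {p w B : 𝓞 K} (hp : Prime p) (hp3 : ¬ p ∣ 3) {j k : ℕ}

theorem eisAddChar_pow_mul {m : ℕ} (hm : m ≤ k) (x : 𝓞 K ⧸ Ideal.span {p ^ k}) :
    eisAddChar φ hδ (pow_ne_zero k hp.ne_zero)
      (Ideal.Quotient.mk (Ideal.span {p ^ k}) p ^ (k - m) * x) =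
      eisAddChar φ hδ (pow_ne_zero m hp.ne_zero) (reductionPow p hm x) := by
  obtain ⟨a, rfl⟩ := Ideal.Quotient.mk_surjective x
  rw [reductionPow_mk, ← map_pow, ← map_mul, eisAddChar_apply, eisAddChar_apply,
    eisExpMod_mk φ hδ (pow_ne_zero k hp.ne_zero), eisExpMod_mk φ hδ (pow_ne_zero m hp.ne_zero)]
  congr 1
  have hpK : (p : K) ≠ 0 := by simpa using hp.ne_zero
  have hk : (p : K) ^ k = (p : K) ^ (k - m) * (p : K) ^ m := by
    rw [← pow_add, Nat.sub_add_cancel hm]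
  push_cast
  rw [hk, mul_div_mul_left _ _ (pow_ne_zero _ hpK)]

theorem eisAddChar_pow_pred_mul (hk : 1 ≤ k) (x : 𝓞 K ⧸ Ideal.span {p ^ k}) :
    eisAddChar φ hδ (pow_ne_zero k hp.ne_zero)
      (Ideal.Quotient.mk (Ideal.span {p ^ k}) p ^ (k - 1) * x) =
      eisAddChar φ hδ hp.ne_zero (reduction p hk x) := by
  obtain ⟨a, rfl⟩ := Ideal.Quotient.mk_surjective x
  rw [reduction_mk, ← map_pow, ← map_mul, eisAddChar_apply, eisAddChar_apply,
    eisExpMod_mk φ hδ (pow_ne_zero k hp.ne_zero), eisExpMod_mk φ hδ hp.ne_zero]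
  congr 1
  have hpK : (p : K) ≠ 0 := by simpa using hp.ne_zero
  have hk : (p : K) ^ k = (p : K) ^ (k - 1) * p := by
    rw [← pow_succ, Nat.sub_add_cancel hk]
  push_cast
  rw [hk, mul_div_mul_left _ _ (pow_ne_zero _ hpK)]

theorem cubicGauss_eq_gaussSum [Fintype (𝓞 K ⧸ Ideal.span {p})] :
    cubicGauss φ δ p = gaussSum (cubicChar φ hp hp3) (eisAddChar φ hδ hp.ne_zero) := by
  classical
  rw [cubicGauss, finsum_eq_sum_of_fintype, gaussSum]
  refine (sum_units_eq_sum (fun x => cubicChar φ hp hp3 x * eisAddChar φ hδ hp.ne_zero x) ?_)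
  intro x hx
  rw [MulChar.map_nonunit _ hx, zero_mul]

theorem twistedCubicSum_eq (hk : 1 ≤ k) [Fintype (𝓞 K ⧸ Ideal.span {p ^ k})]
    [Fintype (𝓞 K ⧸ Ideal.span {p})] :
    letI := residueField hp
    twistedCubicSum φ δ p (p ^ 3) w B j k = truncatedCubicSum (reduction p hk)
      (eisAddChar φ hδ (pow_ne_zero k hp.ne_zero)) (cubicChar φ hp hp3)
      (Ideal.Quotient.mk _ p) (Ideal.Quotient.mk _ w) (Ideal.Quotient.mk _ B) j k := by
  classical
  let _ := residueField hp
  rw [truncatedCubicSum, ← sum_units_eq_sum]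
  · simp only [twistedCubicSum, finsum_eq_sum_of_fintype]
    refine Finset.sum_congr rfl fun A _ => ?_
    rw [mul_assoc, map_pow]
    congr 1
    obtain ⟨a, ha⟩ := Ideal.Quotient.mk_surjective (A : 𝓞 K ⧸ Ideal.span {p ^ k})
    have h1 : (A : 𝓞 K ⧸ Ideal.span {p ^ k}) = Ideal.Quotient.mk _
        (Quotient.out (A : 𝓞 K ⧸ Ideal.span {p ^ k})) := (Quotient.out_eq _).symm
    rw [cubicSymbolPow]
    conv_rhs => rw [h1, reduction_mk]
    rw [cubicChar_mk]
  -- The sum over units extends to all of R because χ(A)^k = 0 at nonunits; this needs k ≥ 1.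
  · intro A hA
    rw [(isTruncatedDVR_reduction hp hk).isUnit_iff, not_not] at hA
    rw [hA, MulChar.map_zero, zero_pow (by omega), zero_mul]

end Evaluation
end

/-! ### Evaluation over the ring of integers and nonvanishing -/

noncomputable section

theorem not_dvd_of_isCoprime {R : Type*} [CommRing R] {p a : R} (hp : Prime p) (h : IsCoprime a p) : ¬ p ∣ a :=
  fun hd => hp.not_isUnit (h.isUnit_of_dvd' hd dvd_rfl)

theorem map_inverse {R S : Type*} [CommRing R] [CommRing S] (f : R →+* S) {x : R}
    (hx : IsUnit x) : f (Ring.inverse x) = Ring.inverse (f x) := by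
  have h1 := congrArg f (Ring.inverse_mul_cancel x hx)
  have h2 := Ring.mul_inverse_cancel _ (hx.map f)
  rw [map_mul, map_one] at h1
  linear_combination Ring.inverse (f x) * h1 - f (Ring.inverse x) * h2

/-- The two terms have absolute values √N and N, which differ for N > 1. -/
theorem neg_mul_add_ne_zero {N : ℕ} (hN : 1 < N) {u g c : ℂ} (hu : ‖u‖ = 1) (hg : ‖g‖ ^ 2 = N)
    (hc : ‖c‖ = 1) : u * g * (-1 : ℤ) + N * c ≠ 0 := by
  intro h
  have h1 : u * g = N * c := by
    push_cast at h
    linear_combination -h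
  have h2 := congrArg (fun z => ‖z‖ ^ 2) h1
  simp only [norm_mul, hu, hc, one_mul, mul_one, hg, Complex.norm_natCast] at h2
  have h3 : N = N ^ 2 := by exact_mod_cast h2
  nlinarith

variable {K : Type*} [Field K] [NumberField K]

section Evaluation

variable [IsCyclotomicExtension {3} ℚ K] (φ : K →+* ℂ) {δ : K} (hδ : δ ^ 2 = -3)
  {p w B : 𝓞 K} (hp : Prime p) (hp3 : ¬ p ∣ 3) {j k : ℕ}

theorem cubePhase_eq {c : 𝓞 K} (hc : c ≠ 0) : cubePhase φ δ c w B =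
    eisAddChar φ hδ hc (Ideal.Quotient.mk _ B ^ 3 *
      Ring.inverse (3 ^ 3 * Ideal.Quotient.mk _ w)) := rfl

include hδ in
theorem norm_cubePhase {c : 𝓞 K} (hc : c ≠ 0) : ‖cubePhase φ δ c w B‖ = 1 := by
  have := finite_quotient_span hc
  rw [cubePhase_eq φ hδ hc]
  exact AddChar.norm_apply _ _

include hp hp3 in
theorem norm_cubicSymbol {a : 𝓞 K} (ha : ¬ p ∣ a) : ‖cubicSymbol φ p a‖ = 1 := by
  obtain ⟨ζ, hζ, h⟩ := exists_cubicSymbol hp hp3 ha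
  rw [cubicSymbol_eq φ hp3 hζ h]
  refine Complex.norm_eq_one_of_pow_eq_one (n := 3) ?_ (by norm_num)
  rw [← map_pow, ← map_pow, hζ]
  simp

include hδ hp hp3

theorem norm_cubicGauss_sq : ‖cubicGauss φ δ p‖ ^ 2 = eisNorm p := by
  classical
  let _ := residueField hp
  have := finite_quotient_span hp.ne_zero
  let _ := Fintype.ofFinite (𝓞 K ⧸ Ideal.span {p})
  rw [cubicGauss_eq_gaussSum φ hδ hp hp3, ← card_quotient_span, Nat.card_eq_fintype_card]
  exact norm_gaussSum_sq (cubicChar_ne_one φ hp hp3) (eisAddChar_isPrimitive φ hδ hp.ne_zero)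

theorem twistedCubicSum_pow_one (hw : ¬ p ∣ w) (hj : 1 ≤ j) :
    twistedCubicSum φ δ p (p ^ 3) w B j 1 =
      eisPhi p * cubicSymbol φ p w * cubicGauss φ δ p := by
  let _ := residueField hp
  have := finite_quotient_span hp.ne_zero
  have := finite_quotient_span (pow_ne_zero 1 hp.ne_zero)
  let _ := Fintype.ofFinite (𝓞 K ⧸ Ideal.span {p})
  let _ := Fintype.ofFinite (𝓞 K ⧸ Ideal.span {p ^ 1})
  have h := isTruncatedDVR_reduction hp le_rfl
  have hπ : Ideal.Quotient.mk (Ideal.span {p ^ 1}) p = 0 := by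
    exact (pow_one _).symm.trans (h.pow_eq_zero (m := 1) le_rfl)
  rw [twistedCubicSum_eq φ hδ hp hp3 le_rfl,
    truncatedCubicSum_one (cubicChar_pow_three φ hp hp3) (cubicChar_ne_one φ hp hp3)
      ⟨(injective_iff_map_eq_zero _).mpr ?_, h.surjective⟩ hπ
      (ψ' := eisAddChar φ hδ hp.ne_zero) ?_ ?_ hj,
    reduction_mk, cubicChar_mk, ← cubicGauss_eq_gaussSum φ hδ hp hp3, eisPhi]
  · intro x hx
    rw [h.map_eq_zero_iff, hπ] at hx
    exact zero_dvd_iff.mp hx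
  · intro x
    rw [← eisAddChar_pow_pred_mul φ hδ hp le_rfl, Nat.sub_self, pow_zero, one_mul]
  · rw [reduction_mk, Ne, mk_span_eq_zero_iff]
    exact hw

theorem twistedCubicSum_evaluation (hw : ¬ p ∣ w) (hB : ¬ p ∣ B) (hj : 1 ≤ j) (hk : 2 ≤ k) :
    twistedCubicSum φ δ p (p ^ 3) w B j k =
      if k = 2 ∨ j = 1 then 0
      else if k = 3 then eisPhi (p ^ 3) * (eisNorm p : ℂ) ^ 2
      else if k = 4 then (eisNorm p : ℂ) ^ 5 * (cubicSymbol φ p w * cubicGauss φ δ p * eisMoebius p +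
        eisNorm p * if j = 2 then cubePhase φ δ p w B else 1)
      else if j = 2 then (eisNorm p : ℂ) ^ (k + 2) * cubePhase φ δ (p ^ (k - 3)) w B
      else 0 := by
  classical
  let _ := residueField hp
  have := finite_quotient_span hp.ne_zero
  have := finite_quotient_span (pow_ne_zero k hp.ne_zero)
  let _ := Fintype.ofFinite (𝓞 K ⧸ Ideal.span {p})
  let _ := Fintype.ofFinite (𝓞 K ⧸ Ideal.span {p ^ k})
  have hk1 : 1 ≤ k := by omega
  have h := isTruncatedDVR_reduction hp hk1
  have hψ := eisAddChar_isPrimitive φ hδ (pow_ne_zero k hp.ne_zero)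
  have hχ := cubicChar_pow_three φ hp hp3
  have hχ1 := cubicChar_ne_one φ hp hp3
  have h3 : (3 : 𝓞 K ⧸ Ideal.span {p}) ≠ 0 := by
    rw [← map_ofNat (Ideal.Quotient.mk (Ideal.span {p})), Ne, mk_span_eq_zero_iff]
    exact hp3
  have hcard : (Fintype.card (𝓞 K ⧸ Ideal.span {p}) : ℂ) = eisNorm p := by
    rw [← Nat.card_eq_fintype_card, card_quotient_span]
  have hrw : reduction p hk1 (Ideal.Quotient.mk _ w) ≠ 0 := by
    rwa [reduction_mk, Ne, mk_span_eq_zero_iff]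
  have hrB : reduction p hk1 (Ideal.Quotient.mk _ B) ≠ 0 := by
    rwa [reduction_mk, Ne, mk_span_eq_zero_iff]
  obtain ⟨η, hη⟩ := exists_cube_root_of_unity (K := K)
  have hηc : ∀ c : 𝓞 K, Ideal.Quotient.mk (Ideal.span {c}) η ^ 2 +
      Ideal.Quotient.mk (Ideal.span {c}) η + 1 = 0 := by
    intro c
    rw [← map_pow, ← map_add, ← map_one (Ideal.Quotient.mk _), ← map_add, hη, map_zero]
  have hr : k = 4 → ∀ x, eisAddChar φ hδ (pow_ne_zero k hp.ne_zero)
      (Ideal.Quotient.mk (Ideal.span {p ^ k}) p ^ 3 * x) =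
      eisAddChar φ hδ hp.ne_zero (reduction p hk1 x) := by
    intro h₃ x
    rw [← eisAddChar_pow_pred_mul φ hδ hp hk1, show k - 1 = 3 by omega]
  rw [twistedCubicSum_eq φ hδ hp hp3 hk1]
  split_ifs with h₁ h₂ h₃ h₄ h₅
  · rcases h₁ with h₁ | h₁
    · exact h.truncatedCubicSum_two hψ _ h3 hχ hχ1 hrw hj h₁
    · rcases hk.eq_or_lt with h₂ | h₂
      · exact h.truncatedCubicSum_two hψ _ h3 hχ hχ1 hrw hj h₂.symm
      · exact h.truncatedCubicSum_of_eq_one hψ _ h3 hrw hrB h₁ h₂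
  · rw [h.truncatedCubicSum_three hψ _ h3 hχ hrw (by omega) h₂, hcard, eisPhi, h₂]
  · rw [h.truncatedCubicSum_four hψ _ h3 hχ hχ1 (hηc p) hrw (by omega) h₃
      (eisAddChar_isPrimitive φ hδ hp.ne_zero) (hr h₃), hcard, eisMoebius_eq_neg_one hp,
      cubePhase_eq φ hδ hp.ne_zero, h₄, ← cubicGauss_eq_gaussSum φ hδ hp hp3, reduction_mk,
      cubicChar_mk, Nat.sub_self, pow_zero, one_mul, reduction_mk, ← Ring.inverse_eq_inv']
    push_cast
    ring
  -- For j ≥ 3 the factor p^(j-2) reduces to 0, so the cubic phase becomes 1.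
  · rw [h.truncatedCubicSum_four hψ _ h3 hχ hχ1 (hηc p) hrw (by omega) h₃
      (eisAddChar_isPrimitive φ hδ hp.ne_zero) (hr h₃), hcard, eisMoebius_eq_neg_one hp,
      map_mul (reduction p hk1), map_pow (reduction p hk1), h.map_uniformizer,
      zero_pow (by omega), zero_mul, zero_pow (by norm_num), zero_mul, AddChar.map_zero_eq_one,
      ← cubicGauss_eq_gaussSum φ hδ hp hp3, reduction_mk, cubicChar_mk]
    push_cast
    ring
  · rw [h.truncatedCubicSum_of_eq_two hψ _ h3 hχ (hηc _) hrw hrB h₅ (by omega), hcard,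
      cubePhase_eq φ hδ (pow_ne_zero _ hp.ne_zero)]
    congr 1
    have hm : k - 3 ≤ k := Nat.sub_le _ _
    have h27 : IsUnit (3 ^ 3 * Ideal.Quotient.mk (Ideal.span {p ^ k}) w) := by
      rw [h.isUnit_iff, map_mul, map_pow, map_ofNat]
      exact mul_ne_zero (pow_ne_zero _ h3) hrw
    -- The factor p³ lowers the modulus from p^k to p^(k-3); the inverse of 27w is compatible with
    -- this reduction because 27w is a unit modulo p^k.
    have := eisAddChar_pow_mul φ hδ hp hm (Ideal.Quotient.mk _ B ^ 3 *
      Ring.inverse (3 ^ 3 * Ideal.Quotient.mk _ w))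
    rw [Nat.sub_sub_self (by omega)] at this
    rw [this]
    congr 1
    rw [map_mul, map_inverse _ h27, map_pow, map_mul, map_pow, map_ofNat, reductionPow_mk,
      reductionPow_mk]
  · exact h.truncatedCubicSum_eq_zero hψ _ h3 hrw (by omega) (by omega)

end Evaluation
end

theorem mainTheorem5 {K : Type*} [Field K] [NumberField K] [IsCyclotomicExtension {3} ℚ K]
    (φ : K →+* ℂ) (δ : K) (hδ : δ ^ 2 = -3)
    (p w B : 𝓞 K) (hp : Prime p) (hp3 : ¬ p ∣ 3) (hwB : IsCoprime (w * B) p)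
    (j k : ℕ) (hj : 1 ≤ j) (hk : 1 ≤ k) :
    (k = 1 → twistedCubicSum φ δ p (p ^ 3) w B j k =
      eisPhi p * cubicSymbol φ p w * cubicGauss φ δ p) ∧
    (k = 3 → 2 ≤ j → twistedCubicSum φ δ p (p ^ 3) w B j k =
      eisPhi (p ^ 3) * (eisNorm p : ℂ) ^ 2) ∧
    (k = 4 → j = 2 → twistedCubicSum φ δ p (p ^ 3) w B j k =
      (eisNorm p : ℂ) ^ 5 * (cubicSymbol φ p w * cubicGauss φ δ p * eisMoebius p +
        eisNorm p * cubePhase φ δ p w B)) ∧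
    (k = 4 → 3 ≤ j → twistedCubicSum φ δ p (p ^ 3) w B j k =
      (eisNorm p : ℂ) ^ 5 * (cubicSymbol φ p w * cubicGauss φ δ p * eisMoebius p +
        eisNorm p)) ∧
    (5 ≤ k → j = 2 → twistedCubicSum φ δ p (p ^ 3) w B j k =
      (eisNorm p : ℂ) ^ (k + 2) * cubePhase φ δ (p ^ (k - 3)) w B) ∧
    (twistedCubicSum φ δ p (p ^ 3) w B j k ≠ 0 ↔
      k = 1 ∨ (k = 3 ∧ 2 ≤ j) ∨ (k = 4 ∧ 2 ≤ j) ∨ (5 ≤ k ∧ j = 2)) := by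
  have hw : ¬ p ∣ w := not_dvd_of_isCoprime hp hwB.of_mul_left_left
  have hB : ¬ p ∣ B := not_dvd_of_isCoprime hp hwB.of_mul_left_right
  have hN := one_lt_eisNorm hp
  have hN0 : (eisNorm p : ℂ) ≠ 0 := by
    rw [Nat.cast_ne_zero]
    omega
  have hg := norm_cubicGauss_sq φ hδ hp hp3
  have hphi : ∀ c : 𝓞 K, c ≠ 0 → (eisPhi c : ℂ) ≠ 0 := by
    intro c hc
    have := finite_quotient_span hc
    rw [Nat.cast_ne_zero, eisPhi]
    exact Nat.card_pos.ne'
  have hsymb := norm_cubicSymbol φ hp hp3 hw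
  rcases hk.eq_or_lt with rfl | hk2
  · have h1 := twistedCubicSum_pow_one φ hδ hp hp3 (B := B) hw hj
    refine ⟨fun _ => h1, by omega, by omega, by omega, by omega, fun _ => Or.inl rfl, fun _ => ?_⟩
    rw [h1]
    refine mul_ne_zero (mul_ne_zero (hphi p hp.ne_zero) ?_) ?_
    · rw [← norm_ne_zero_iff, hsymb]
      exact one_ne_zero
    · rw [← norm_ne_zero_iff, ← pow_ne_zero_iff two_ne_zero, hg, Nat.cast_ne_zero]
      omega
  have hev := twistedCubicSum_evaluation φ hδ hp hp3 hw hB hj hk2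
  refine ⟨by omega, ?_, ?_, ?_, ?_, ?_⟩
  · intro h1 h2
    rw [hev, if_neg (by omega), if_pos h1]
  · intro h1 h2
    rw [hev, if_neg (by omega), if_neg (by omega), if_pos h1, if_pos h2]
  · intro h1 h2
    rw [hev, if_neg (by omega), if_neg (by omega), if_pos h1, if_neg (by omega), mul_one]
  · intro h1 h2
    rw [hev, if_neg (by omega), if_neg (by omega), if_neg (by omega), if_pos h2]
  · rw [hev]
    split_ifs with h1 h2 h3 h4 h5
    · simp only [ne_eq, not_true_eq_false, false_iff]
      omega
    · have := mul_ne_zero (hphi _ (pow_ne_zero 3 hp.ne_zero)) (pow_ne_zero 2 hN0)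
      simp only [ne_eq, this, not_false_eq_true, true_iff]
      omega
    · have := mul_ne_zero (pow_ne_zero 5 hN0) (neg_mul_add_ne_zero hN hsymb hg
        (norm_cubePhase φ hδ (w := w) (B := B) hp.ne_zero))
      rw [eisMoebius_eq_neg_one hp]
      simp only [ne_eq, this, not_false_eq_true, true_iff]
      omega
    · have := mul_ne_zero (pow_ne_zero 5 hN0) (neg_mul_add_ne_zero hN hsymb hg norm_one)
      rw [eisMoebius_eq_neg_one hp]
      simp only [ne_eq, this, not_false_eq_true, true_iff]
      omega
    · have hc : cubePhase φ δ (p ^ (k - 3)) w B ≠ 0 := by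
        rw [← norm_ne_zero_iff, norm_cubePhase φ hδ (pow_ne_zero _ hp.ne_zero)]
        exact one_ne_zero
      have := mul_ne_zero (pow_ne_zero (k + 2) hN0) hc
      simp only [ne_eq, this, not_false_eq_true, true_iff]
      omega
    · simp only [ne_eq, not_true_eq_false, false_iff]
      omega
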